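/- Let $G=(V,E,w_G)$ be a finite connected undirected graph on $n$ vertices without self-loops, with positive edge weights $w_G$, and let $H,s$ be positive integers. Let $Z$ be the pure $H$-dimensional simplicial complex with vertex set $V\times[s]$ whose $H$-dimensional faces are the sets $\sigma=\{(v_1,b_1),\dots,(v_{H+1},b_{H+1})\}$ such that $b_1,\dots,b_{H+1}$ are distinct and $\{v_1,\dots,v_{H+1}\}=\{u,v\}$ for some edge $\{u,v\}\in E$; such a face with $|\{i:v_i=u\}|=j$ has weight $m(\sigma)=w_G(\{u,v\})/\binom{H-1}{j-1}$. The weights of lower-dimensional faces, down to the empty face (of dimension $-1$), are determined by $m(\sigma)=\sum_{\tau\supset\sigma,\ \dim\tau=\dim\sigma+1}m(\tau)$. The link of a face $\sigma$ is $Z_\sigma=\{\tau\setminus\sigma:\sigma\subseteq\tau\in Z\}$ with weights $m_\sigma(\tau\setminus\sigma)=m(\tau)$, and its 1-skeleton is the graph of its vertices and edges with edge weights $m_\sigma$. For a weighted graph with adjacency matrix $M$ and diagonal matrix $D$ of weighted degrees, the spectral gap is $\nu_2=1-\omega_2$, where $\omega_2$ is the second largest eigenvalue, with multiplicity, of $MD^{-1}$.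 Let $\nu^{(k)}(Z)$ be the minimum, over the $k$-dimensional faces $\sigma$ of $Z$, of the spectral gap of the 1-skeleton of $Z_\sigma$; in particular $\nu^{(-1)}(Z)$ is the spectral gap of the 1-skeleton of $Z$. Assume $H\ge 2$, $s\ge 2H$ and $n\ge 4$. Then for every $0\le k\le H-2$, $$\nu^{(k)}(Z)=\frac{k+1}{k+2},$$ and moreover the 1-skeleton of $Z_\sigma$ has spectral gap exactly $\frac{k+1}{k+2}$ for every $k$-dimensional face $\sigma$, except possibly those contained in $\{u\}\times[s]$ for a vertex $u$ that has only one neighbour in $G$ (for which the gap is at least $\frac{k+1}{k+2}$). Furthermore, $$\nu^{(-1)}(Z)=\frac{\nu_2(G)}{\sum_{\ell=1}^H 1/\ell}\ \ge\ \frac{\nu_2(G)}{1+\log H}.$$ -/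

import Mathlib

open Finset

noncomputable section

/-- An undirected graph without self-loops, with a real weight for each edge
(only the values of `weight` on edges of `graph` are ever used). -/
structure WeightedGraph (V : Type*) where
  graph : SimpleGraph V
  weight : Sym2 V → ℝ

/-- The eigenvalues of a real square matrix (the roots in `ℝ` of its characteristic polynomial,
with multiplicity), listed from greatest to least. -/
def sortedEigenvalues {V : Type*} [Fintype V] [DecidableEq V] (W : Matrix V V ℝ) : List ℝ :=
  W.charpoly.roots.sort (· ≥ ·)

namespace WeightedGraph

variable {V : Type*} (G : WeightedGraph V)

open Classical in
/-- The weighted adjacency matrix `M_G`. -/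
def adjMatrix : Matrix V V ℝ :=
  Matrix.of fun x y => if G.graph.Adj x y then G.weight s(x, y) else 0

/-- The weighted degree of a vertex. -/
def degree [Fintype V] (x : V) : ℝ := ∑ y, G.adjMatrix x y

/-- The random walk matrix `W_G = M_G D_G⁻¹`. -/
def walkMatrix [Fintype V] [DecidableEq V] : Matrix V V ℝ :=
  G.adjMatrix * Matrix.diagonal fun x => (G.degree x)⁻¹

/-- The second largest eigenvalue `ω₂(G)` of the random walk matrix, with multiplicity
(position `1` in the list, which starts at position `0`). -/
def secondEigenvalue [Fintype V] [DecidableEq V] : ℝ :=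
  (sortedEigenvalues G.walkMatrix).getD 1 0

/-- The expansion (spectral gap) `ν₂(G) = 1 - ω₂(G)`. -/
def spectralGap [Fintype V] [DecidableEq V] : ℝ := 1 - G.secondEigenvalue

end WeightedGraph

/-- A finite simplicial complex (the empty face is allowed as a face, of dimension `-1`),
with a real weight for each face. -/
structure WeightedComplex (α : Type*) where
  faces : Finset (Finset α)
  down_closed : ∀ σ ∈ faces, ∀ ρ ⊆ σ, ρ ∈ faces
  weight : Finset α → ℝ

namespace WeightedComplex

variable {α : Type*} (X : WeightedComplex α)

/-- `X(k)`, the faces of dimension `k`, for an integer `k ≥ -1`. -/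
def facesOfDim (k : ℤ) : Finset (Finset α) := {σ ∈ X.faces | (#σ : ℤ) = k + 1}

variable [DecidableEq α]

/-- Every face is contained in a face of dimension `H`, and no face has larger dimension. -/
def IsPure (H : ℕ) : Prop :=
  ∀ σ ∈ X.faces, #σ ≤ H + 1 ∧ ∃ τ ∈ X.facesOfDim H, σ ⊆ τ

/-- The weight of each face of dimension `-1 ≤ k < H` is the sum of the weights of the faces of
dimension `k + 1` that contain it. -/
def IsBalanced (H : ℕ) : Prop :=
  ∀ k : ℤ, -1 ≤ k → k < H → ∀ σ ∈ X.facesOfDim k,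
    X.weight σ = ∑ τ ∈ X.facesOfDim (k + 1) with σ ⊆ τ, X.weight τ

/-- The link `X_σ = {τ \ σ : σ ⊆ τ ∈ X}` with the weights `m_σ(τ \ σ) = m(τ)`. -/
def link (σ : Finset α) : WeightedComplex α where
  faces := {τ ∈ X.faces | σ ⊆ τ}.image (· \ σ)
  down_closed := by
    intro ρ hρ ρ' hρ'
    simp only [mem_image, mem_filter] at hρ ⊢
    obtain ⟨τ, ⟨hτ, hστ⟩, rfl⟩ := hρ
    have hd : Disjoint ρ' σ := disjoint_of_subset_left hρ' sdiff_disjoint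
    refine ⟨ρ' ∪ σ, ⟨X.down_closed τ hτ _ ?_, subset_union_right⟩, ?_⟩
    · exact union_subset (hρ'.trans sdiff_subset) hστ
    · rw [union_sdiff_right, sdiff_eq_self_of_disjoint hd]
  weight := fun ρ => X.weight (ρ ∪ σ)

/-- The vertices of `X`. -/
abbrev Vertex : Type _ := {x : α // {x} ∈ X.faces}

/-- The 1-skeleton `(X(0), X(1), m)` as a weighted graph: its edges are the 1-dimensional faces,
weighted by `m`. -/
def skeleton : WeightedGraph X.Vertex where
  graph := SimpleGraph.fromRel fun x y => {x.1, y.1} ∈ X.faces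
  weight := fun e => X.weight (e.map Subtype.val).toFinset

/-- The expansion of the 1-skeleton of the link of `σ`. -/
def linkGap [Fintype α] (σ : Finset α) : ℝ := (X.link σ).skeleton.spectralGap

/-- `ν^{(k)}(X) = a`: the number `a` is the minimum of the expansions of the 1-skeletons of
the links of the `k`-dimensional faces of `X`. -/
def HasLocalExpansion [Fintype α] (k : ℤ) (a : ℝ) : Prop :=
  IsLeast (X.linkGap '' (X.facesOfDim k : Set (Finset α))) a

end WeightedComplex

/-- Downward propagation of a weight function `top` along a family `F` of faces: the value at `σ`
is `top σ` after `0` steps, and after `i + 1` steps it is the sum, over the faces `τ ⊇ σ` with one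
more element, of the values at `τ` after `i` steps. -/
def propagate {α : Type*} [DecidableEq α] (F : Finset (Finset α)) (top : Finset α → ℝ) :
    ℕ → Finset α → ℝ
  | 0, σ => top σ
  | i + 1, σ => ∑ τ ∈ F with σ ⊆ τ ∧ #τ = #σ + 1, propagate F top i τ

namespace WeightedGraph

variable {V : Type*} [DecidableEq V] (G : WeightedGraph V) (H s : ℕ)

open Classical in
/-- `Z(H)`: the sets of `H + 1` elements of `V(G) × [s]` whose first components form an edge of `G`
and whose second components are distinct. -/
def productTopFaces [Fintype V] : Finset (Finset (V × Fin s)) :=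
  {σ | #σ = H + 1 ∧ (∃ u v, G.graph.Adj u v ∧ σ.image Prod.fst = {u, v}) ∧
    Set.InjOn Prod.snd (σ : Set (V × Fin s))}

open Classical in
/-- The weight `w_G({u, v}) / C(H - 1, j - 1)` of a face of dimension `H` that has `j` of its
`H + 1` elements above `u` and the others above `v`. The choice of the order of `u` and `v` has
no influence, see `productTopWeight_eq`. -/
def productTopWeight (σ : Finset (V × Fin s)) : ℝ :=
  if h : ∃ p : V × V, G.graph.Adj p.1 p.2 ∧ σ.image Prod.fst = {p.1, p.2} then
    G.weight s(h.choose.1, h.choose.2) /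
      ((H - 1).choose (#{x ∈ σ | x.1 = h.choose.1} - 1) : ℕ)
  else 0

theorem productTopWeight_eq {σ : Finset (V × Fin s)} (hσ : #σ = H + 1) {u v : V}
    (huv : G.graph.Adj u v) (hI : σ.image Prod.fst = {u, v}) :
    G.productTopWeight H s σ =
      G.weight s(u, v) / ((H - 1).choose (#{x ∈ σ | x.1 = u} - 1) : ℕ) := by
  classical
  have h : ∃ p : V × V, G.graph.Adj p.1 p.2 ∧ σ.image Prod.fst = {p.1, p.2} := ⟨(u, v), huv, hI⟩
  rw [productTopWeight, dif_pos h]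
  obtain ⟨hadj, hc⟩ := h.choose_spec
  set p := h.choose
  have hne := huv.ne
  have hpne := hadj.ne
  have hpair : ({p.1, p.2} : Finset V) = {u, v} := hc.symm.trans hI
  have h1 : p.1 = u ∨ p.1 = v := by
    have : p.1 ∈ ({u, v} : Finset V) := hpair ▸ mem_insert_self _ _
    simpa using this
  have h2 : p.2 = u ∨ p.2 = v := by
    have : p.2 ∈ ({u, v} : Finset V) := hpair ▸ (by simp)
    simpa using this
  rcases h1 with h1 | h1
  · have h2' : p.2 = v := by
      rcases h2 with h2 | h2
      · exact absurd (h1.trans h2.symm) hpne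
      · exact h2
    rw [h1, h2']
  · have h2' : p.2 = u := by
      rcases h2 with h2 | h2
      · exact h2
      · exact absurd (h1.trans h2.symm) hpne
    rw [h1, h2', Sym2.eq_swap]
    have hsum : #{x ∈ σ | x.1 = u} + #{x ∈ σ | x.1 = v} = H + 1 := by
      rw [← hσ, ← card_union_of_disjoint]
      · congr 1
        ext x
        simp only [mem_union, mem_filter]
        refine ⟨fun hx => hx.elim And.left And.left, fun hx => ?_⟩
        have : x.1 ∈ ({u, v} : Finset V) := hI ▸ mem_image_of_mem _ hx
        simp only [mem_insert, mem_singleton] at this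
        exact this.imp (⟨hx, ·⟩) (⟨hx, ·⟩)
      · rw [disjoint_filter]
        intro x _ hx hx'
        exact hne (hx.symm.trans hx')
    have hpos : ∀ w ∈ ({u, v} : Finset V), 0 < #{x ∈ σ | x.1 = w} := by
      intro w hw
      rw [← hI, mem_image] at hw
      obtain ⟨x, hx, rfl⟩ := hw
      exact card_pos.2 ⟨x, by simp [hx]⟩
    have hu := hpos u (by simp)
    have hv := hpos v (by simp)
    rw [Nat.choose_symm_of_eq_add (a := #{x ∈ σ | x.1 = v} - 1) (b := #{x ∈ σ | x.1 = u} - 1)]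
    omega

variable [Fintype V]

/-- The complex `Z` built from `G`, `H` and `s`: its faces are the subsets of the faces of
dimension `H`, and the weights of those are propagated downwards. -/
def productComplex : WeightedComplex (V × Fin s) where
  faces := {σ | ∃ τ ∈ G.productTopFaces H s, σ ⊆ τ}
  down_closed := by
    intro σ hσ ρ hρ
    simp only [mem_filter, mem_univ, true_and] at hσ ⊢
    obtain ⟨τ, hτ, hστ⟩ := hσ
    exact ⟨τ, hτ, hρ.trans hστ⟩
  weight := fun σ =>
    propagate {σ | ∃ τ ∈ G.productTopFaces H s, σ ⊆ τ} (G.productTopWeight H s) (H + 1 - #σ) σ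

theorem productComplex_facesOfDim_top :
    (G.productComplex H s).facesOfDim H = G.productTopFaces H s := by
  ext σ
  simp only [WeightedComplex.facesOfDim, productComplex, mem_filter, mem_univ, true_and]
  constructor
  · rintro ⟨⟨τ, hτ, hστ⟩, hc⟩
    have hτc : #τ = H + 1 := by
      simp only [productTopFaces, mem_filter] at hτ
      exact hτ.2.1
    rwa [eq_of_subset_of_card_le hστ (by omega)]
  · intro hσ
    refine ⟨⟨σ, hσ, Subset.rfl⟩, ?_⟩
    simp only [productTopFaces, mem_filter] at hσ
    exact_mod_cast hσ.2.1

theorem productComplex_isPure : (G.productComplex H s).IsPure H := by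
  intro σ hσ
  rw [productComplex_facesOfDim_top]
  simp only [productComplex, mem_filter, mem_univ, true_and] at hσ
  obtain ⟨τ, hτ, hστ⟩ := hσ
  refine ⟨(card_le_card hστ).trans ?_, τ, hτ, hστ⟩
  simp only [productTopFaces, mem_filter] at hτ
  exact hτ.2.1.le

theorem productComplex_weight_top {σ : Finset (V × Fin s)} (hσ : σ ∈ G.productTopFaces H s) :
    (G.productComplex H s).weight σ = G.productTopWeight H s σ := by
  simp only [productTopFaces, mem_filter] at hσ
  simp [productComplex, hσ.2.1, propagate]

theorem productComplex_isBalanced : (G.productComplex H s).IsBalanced H := by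
  intro k hk hkH σ hσ
  simp only [WeightedComplex.facesOfDim, mem_filter] at hσ
  have hi : H + 1 - #σ = (H + 1 - (#σ + 1)) + 1 := by omega
  have hw : (G.productComplex H s).weight σ =
      propagate (G.productComplex H s).faces (G.productTopWeight H s) (H + 1 - #σ) σ := rfl
  rw [hw, hi, propagate]
  refine sum_congr ?_ ?_
  · ext τ
    simp only [WeightedComplex.facesOfDim, mem_filter]
    constructor
    · rintro ⟨h1, h2, h3⟩
      exact ⟨⟨h1, by omega⟩, h2⟩
    · rintro ⟨⟨h1, h3⟩, h2⟩
      exact ⟨h1, h2, by omega⟩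
  · intro τ hτ
    simp only [WeightedComplex.facesOfDim, mem_filter] at hτ
    have hc : #τ = #σ + 1 := by omega
    rw [← hc]
    rfl

end WeightedGraph

end

/-!
Every weight of the complex can be written down. For a face with `t` elements let `c_t` be
`colorFactor H s t`. A face with `a ≥ 1` elements over `u` and `b ≥ 1` over `v` has weight
`c_t w(uv) B(a, b)`, with the Beta function, and a face with all its elements over `u` has weight
`c_t deg(u) h_t`, where `h_t = 1/t + ⋯ + 1/H`. Both follow from the balance condition by downward
induction, since `B(a + 1, b) + B(a, b + 1) = B(a, b)` and `h_t = B(t, 1) + h_{t+1}`; see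
`faceValue_of_image_eq_pair` and `faceValue_of_image_eq_singleton`.

The weight does not depend on the colours, except that these are distinct. So the random walk on the
1-skeleton of the link of `σ` is a Kronecker product of a walk `P` on the vertices of `G` that occur
in the link and the walk on the complete graph of the `m = s - t` unused colours
(`charpoly_walkMatrix_link`). The latter has eigenvalues `1` and `-1/(m - 1)`. As `P` is similar to a
symmetric matrix, the eigenvalues of the product are the products of eigenvalues. The second largest
is that of `P`, because `s` is so large that the products with `-1/(m - 1)` do not exceed it.

If `σ` is not empty, then `P - 1/(t + 1)` has rank at most two. So `P` has the eigenvalues `1`, a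
number `μ` computed from the trace, and `1/(t + 1)` with multiplicity two less than the size of `P`
(`second_eigenvalue_of_rank_le_two`). If `σ` lies over both ends of an edge, then `P` has size two
and `μ = 1/(t + 1)`. If `σ` lies over `u`, then `μ < 1/(t + 1)`, and `1/(t + 1)` itself occurs as
soon as `u` has two neighbours. If `σ` is empty, then `P = (1 - 1/h_1) + (1/h_1) W` with the walk `W`
on `G`. Here the trace of `W` bounds its second eigenvalue below by `-1/(n - 1) ≥ -1/3`, which
suffices to see that the products with `-1/(s - 1)` are not too large (`linkGap_empty`).
-/

/-! ### Matrices diagonalizable over the reals -/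

section Diagonalization

variable {ι κ : Type*} [Fintype ι] [DecidableEq ι] [Fintype κ] [DecidableEq κ]

/-- `P` is similar over `ℝ` to the diagonal matrix with entries `d`; the matrices `S` and `T` are
mutually inverse. So `d` lists the eigenvalues of `P` with multiplicity. -/
def DiagonalizedBy (P : Matrix ι ι ℝ) (d : ι → ℝ) : Prop :=
  ∃ S T : Matrix ι ι ℝ, S * T = 1 ∧ P = S * Matrix.diagonal d * T

theorem DiagonalizedBy.roots_charpoly {P : Matrix ι ι ℝ} {d : ι → ℝ} (h : DiagonalizedBy P d) :
    P.charpoly.roots = univ.val.map d := by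
  obtain ⟨S, T, hST, rfl⟩ := h
  rw [Matrix.charpoly_mul_comm, ← Matrix.mul_assoc, mul_eq_one_comm.1 hST, Matrix.one_mul,
    Matrix.charpoly_diagonal, Finset.prod_eq_multiset_prod]
  have h2 := Polynomial.roots_multiset_prod_X_sub_C (univ.val.map d)
  rwa [Multiset.map_map] at h2

theorem DiagonalizedBy.affine {P : Matrix ι ι ℝ} {d : ι → ℝ} (h : DiagonalizedBy P d)
    (a b : ℝ) : DiagonalizedBy (a • (1 : Matrix ι ι ℝ) + b • P) (fun i => a + b * d i) := by
  obtain ⟨S, T, hST, rfl⟩ := h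
  refine ⟨S, T, hST, ?_⟩
  have : Matrix.diagonal (fun i => a + b * d i) =
      a • (1 : Matrix ι ι ℝ) + b • Matrix.diagonal d := by
    ext i j
    by_cases hij : i = j <;> simp [hij, Matrix.diagonal]
  rw [this]
  simp [Matrix.mul_add, Matrix.add_mul, hST]

theorem DiagonalizedBy.trace {P : Matrix ι ι ℝ} {d : ι → ℝ} (h : DiagonalizedBy P d) :
    P.trace = ∑ i, d i := by
  obtain ⟨S, T, hST, rfl⟩ := h
  rw [Matrix.trace_mul_comm, ← Matrix.mul_assoc, mul_eq_one_comm.1 hST, Matrix.one_mul,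
    Matrix.trace_diagonal]

open scoped Kronecker in
theorem DiagonalizedBy.kronecker {P : Matrix ι ι ℝ} {d : ι → ℝ} {Q : Matrix κ κ ℝ} {e : κ → ℝ}
    (hP : DiagonalizedBy P d) (hQ : DiagonalizedBy Q e) :
    DiagonalizedBy (P ⊗ₖ Q) (fun p => d p.1 * e p.2) := by
  obtain ⟨S, T, hST, rfl⟩ := hP
  obtain ⟨S', T', hST', rfl⟩ := hQ
  refine ⟨S ⊗ₖ S', T ⊗ₖ T', ?_, ?_⟩
  · rw [← Matrix.mul_kronecker_mul, hST, hST', Matrix.one_kronecker_one]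
  · rw [Matrix.mul_kronecker_mul, Matrix.mul_kronecker_mul, Matrix.diagonal_kronecker_diagonal]

/-- The number of eigenvalues different from `c`, with multiplicity, is the rank of `P - c`. -/
theorem DiagonalizedBy.card_ne_eq_rank {P : Matrix ι ι ℝ} {d : ι → ℝ} (h : DiagonalizedBy P d)
    (c : ℝ) : #{i | d i ≠ c} = (P - c • 1).rank := by
  have h' := h.affine (-c) 1
  have heq : P - c • (1 : Matrix ι ι ℝ) = (-c) • (1 : Matrix ι ι ℝ) + (1 : ℝ) • P := by
    simp [sub_eq_neg_add]
  rw [heq]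
  obtain ⟨S, T, hST, hP⟩ := h'
  have hS : IsUnit S.det := Matrix.isUnit_det_of_right_inverse hST
  have hT : IsUnit T.det := Matrix.isUnit_det_of_left_inverse hST
  rw [hP, Matrix.rank_mul_eq_left_of_isUnit_det _ _ hT,
    Matrix.rank_mul_eq_right_of_isUnit_det _ _ hS, Matrix.rank_diagonal, Fintype.card_subtype]
  congr 1
  ext i
  simp only [mem_filter, mem_univ, true_and, ne_eq, one_mul, neg_add_eq_zero, eq_comm]

theorem DiagonalizedBy.exists_eq_of_mulVec {P : Matrix ι ι ℝ} {d : ι → ℝ}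
    (h : DiagonalizedBy P d) {f : ι → ℝ} (hf : f ≠ 0) {c : ℝ} (hPf : P.mulVec f = c • f) :
    ∃ i, d i = c := by
  obtain ⟨S, T, hST, rfl⟩ := h
  have hTS := mul_eq_one_comm.1 hST
  have hy : T.mulVec f ≠ 0 := by
    intro h0
    apply hf
    rw [← Matrix.one_mulVec f, ← hST, ← Matrix.mulVec_mulVec, h0, Matrix.mulVec_zero]
  obtain ⟨i, hi⟩ := Function.ne_iff.1 hy
  refine ⟨i, ?_⟩
  have h1 := congrArg T.mulVec hPf
  rw [Matrix.mulVec_mulVec, ← Matrix.mul_assoc, ← Matrix.mul_assoc, hTS, Matrix.one_mul,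
    ← Matrix.mulVec_mulVec, Matrix.mulVec_smul] at h1
  have h2 := congrFun h1 i
  rw [Matrix.mulVec_diagonal, Pi.smul_apply, smul_eq_mul] at h2
  exact mul_right_cancel₀ hi h2

theorem DiagonalizedBy.exists_mulVec_eq {P : Matrix ι ι ℝ} {d : ι → ℝ}
    (h : DiagonalizedBy P d) (i : ι) : ∃ f : ι → ℝ, f ≠ 0 ∧ P.mulVec f = d i • f := by
  obtain ⟨S, T, hST, rfl⟩ := h
  have hTS := mul_eq_one_comm.1 hST
  refine ⟨S.mulVec (Pi.single i 1), ?_, ?_⟩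
  · intro h0
    have h1 := congrArg T.mulVec h0
    rw [Matrix.mulVec_mulVec, hTS, Matrix.one_mulVec, Matrix.mulVec_zero] at h1
    simpa using congrFun h1 i
  · rw [Matrix.mulVec_mulVec, Matrix.mul_assoc, hTS, Matrix.mul_one, ← Matrix.mulVec_mulVec,
      ← Matrix.mulVec_smul]
    congr 1
    ext j
    rw [Matrix.mulVec_diagonal]
    by_cases hj : j = i
    · subst hj; simp
    · simp [hj]

theorem exists_diagonalizedBy_of_isHermitian {A : Matrix ι ι ℝ} (hA : A.IsHermitian) :
    ∃ d, DiagonalizedBy A d := by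
  refine ⟨_, _, _, ?_, hA.spectral_theorem.trans (Unitary.conjStarAlgAut_apply _ _)⟩
  simp

/-- A symmetric matrix times a positive diagonal matrix is similar to a symmetric matrix. -/
theorem exists_diagonalizedBy_mul_diagonal {N : Matrix ι ι ℝ} (hN : N.IsSymm) {D : ι → ℝ}
    (hD : ∀ i, 0 < D i) : ∃ d, DiagonalizedBy (N * Matrix.diagonal fun i => (D i)⁻¹) d := by
  set R : Matrix ι ι ℝ := Matrix.diagonal fun i => √(D i)
  set R' : Matrix ι ι ℝ := Matrix.diagonal fun i => (√(D i))⁻¹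
  have hne : ∀ i, √(D i) ≠ 0 := fun i => (Real.sqrt_pos.2 (hD i)).ne'
  have hRR : R * R' = 1 := by simp [R, R', Matrix.diagonal_mul_diagonal, hne]
  have hR'2 : R' * R' = Matrix.diagonal fun i => (D i)⁻¹ := by
    simp only [R', Matrix.diagonal_mul_diagonal]
    congr 1; ext i
    rw [← mul_inv, Real.mul_self_sqrt (hD i).le]
  have hH : (R' * N * R').IsHermitian := by
    rw [Matrix.IsHermitian, Matrix.conjTranspose_eq_transpose_of_trivial, Matrix.transpose_mul,
      Matrix.transpose_mul, hN.eq, Matrix.diagonal_transpose, Matrix.mul_assoc]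
  obtain ⟨d, S, T, hST, h⟩ := exists_diagonalizedBy_of_isHermitian hH
  refine ⟨d, R * S, T * R', ?_, ?_⟩
  · rw [Matrix.mul_assoc, ← Matrix.mul_assoc S, hST, Matrix.one_mul, hRR]
  · calc _ = (R * R') * N * (R' * R') := by rw [hRR, hR'2, Matrix.one_mul]
      _ = R * (R' * N * R') * R' := by simp only [Matrix.mul_assoc]
      _ = _ := by rw [h]; simp only [Matrix.mul_assoc]

/-- The total mass vector `D` of the rows of `N` is fixed by `N D⁻¹`. -/
theorem mul_diagonal_inv_mulVec {N : Matrix ι ι ℝ} {D : ι → ℝ} (hD : ∀ i, 0 < D i)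
    (hND : ∀ i, ∑ j, N i j = D i) :
    (N * Matrix.diagonal fun i => (D i)⁻¹).mulVec D = (1 : ℝ) • D := by
  ext i
  have : (Matrix.diagonal fun i => (D i)⁻¹).mulVec D = 1 := by
    ext j
    rw [Matrix.mulVec_diagonal, inv_mul_cancel₀ (hD j).ne', Pi.one_apply]
  rw [← Matrix.mulVec_mulVec, this, one_smul, ← hND i]
  simp [Matrix.mulVec, dotProduct]

/-- Eigenvalues of a column-stochastic matrix have absolute value at most `1`: the matrix does not
increase the `ℓ¹` norm of an eigenvector. -/
theorem DiagonalizedBy.abs_le_one {P : Matrix ι ι ℝ} {d : ι → ℝ} (h : DiagonalizedBy P d)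
    (hP : ∀ i j, 0 ≤ P i j) (hcol : ∀ j, ∑ i, P i j = 1) (i : ι) : |d i| ≤ 1 := by
  obtain ⟨f, hf, hPf⟩ := h.exists_mulVec_eq i
  obtain ⟨j, hj⟩ := Function.ne_iff.1 hf
  have hpos : 0 < ∑ x, |f x| :=
    sum_pos' (fun x _ => abs_nonneg _) ⟨j, mem_univ j, abs_pos.2 hj⟩
  have : |d i| * ∑ x, |f x| ≤ 1 * ∑ x, |f x| := by
    calc |d i| * ∑ x, |f x| = ∑ x, |∑ y, P x y * f y| := by
          rw [mul_sum]
          refine sum_congr rfl fun x _ => ?_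
          have := congrFun hPf x
          simp only [Matrix.mulVec, dotProduct, Pi.smul_apply, smul_eq_mul] at this
          rw [this, abs_mul]
      _ ≤ ∑ x, ∑ y, P x y * |f y| := by
          refine sum_le_sum fun x _ => (abs_sum_le_sum_abs _ _).trans (le_of_eq ?_)
          exact sum_congr rfl fun y _ => by rw [abs_mul, abs_of_nonneg (hP x y)]
      _ = 1 * ∑ x, |f x| := by
          rw [sum_comm, one_mul]
          exact sum_congr rfl fun y _ => by rw [← sum_mul, hcol, one_mul]
  exact le_of_mul_le_mul_right this hpos

/-- If `P` has the eigenvalue `1` and `P - c` has rank at most `2`, then the eigenvalues of `P` are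
`1`, `c` with multiplicity `n - 2`, and one more, determined by the trace. -/
theorem DiagonalizedBy.exists_of_rank_le_two {P : Matrix ι ι ℝ} {d : ι → ℝ}
    (h : DiagonalizedBy P d) {c : ℝ} (hc : c ≠ 1) (hrank : (P - c • 1).rank ≤ 2) {i₀ : ι}
    (hi₀ : d i₀ = 1) (hcard : 2 ≤ Fintype.card ι) :
    ∃ i₁ ≠ i₀, d i₁ = P.trace - 1 - (Fintype.card ι - 2) * c ∧
      ∀ j, j ≠ i₀ → j ≠ i₁ → d j = c := by
  rw [← h.card_ne_eq_rank] at hrank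
  set A : Finset ι := {i | d i ≠ c}
  have hiA : i₀ ∈ A := by simp [A, hi₀, hc.symm]
  have hA1 : #(A.erase i₀) ≤ 1 := by rw [card_erase_of_mem hiA]; omega
  have : Nontrivial ι := Fintype.one_lt_card_iff_nontrivial.1 (by omega)
  have hex : ∃ i₁ ≠ i₀, ∀ j, j ≠ i₀ → j ≠ i₁ → d j = c := by
    rcases (A.erase i₀).eq_empty_or_nonempty with he | ⟨i₁, hi₁⟩
    · obtain ⟨i₁, hi₁⟩ := exists_ne i₀
      refine ⟨i₁, hi₁, fun j hj _ => ?_⟩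
      by_contra hjc
      have : j ∈ A.erase i₀ := by simp [A, hj, hjc]
      simp [he] at this
    · refine ⟨i₁, (mem_erase.1 hi₁).1, fun j hj hj1 => ?_⟩
      by_contra hjc
      have : j ∈ A.erase i₀ := by simp [A, hj, hjc]
      exact hj1 (card_le_one.1 hA1 _ this _ hi₁)
  obtain ⟨i₁, hi₁, hrest⟩ := hex
  refine ⟨i₁, hi₁, ?_, hrest⟩
  have hi₁' : i₁ ∈ univ.erase i₀ := by simp [hi₁]
  rw [h.trace, ← add_sum_erase _ _ (mem_univ i₀), ← add_sum_erase _ _ hi₁', hi₀,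
    sum_congr rfl (g := fun _ => c), sum_const, card_erase_of_mem hi₁',
    card_erase_of_mem (mem_univ _), card_univ, nsmul_eq_mul,
    Nat.sub_sub, Nat.cast_sub hcard]
  · push_cast; ring
  · intro j hj
    simp only [mem_erase, mem_univ, and_true] at hj
    exact hrest j hj.2 hj.1

end Diagonalization

/-! ### The second entry of the sorted list of eigenvalues -/

section SecondEigenvalue

variable {ι : Type*} [Fintype ι] [DecidableEq ι]

/-- If `d i₀` is a largest eigenvalue and `d i₁` is a largest one among the others, then `d i₁` is
at position `1` of the sorted list. -/
theorem sortedEigenvalues_getD_one {U : Type*} [Fintype U] [DecidableEq U] {W : Matrix U U ℝ}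
    {d : ι → ℝ} (hW : W.charpoly.roots = univ.val.map d) {i₀ i₁ : ι} (hne : i₁ ≠ i₀)
    (h01 : d i₁ ≤ d i₀) (h : ∀ j, j ≠ i₀ → d j ≤ d i₁) :
    (sortedEigenvalues W).getD 1 0 = d i₁ := by
  have hi₁ : i₁ ∈ univ.erase i₀ := by simp [hne]
  have hm : univ.val.map d = d i₀ ::ₘ d i₁ ::ₘ ((univ.erase i₀).erase i₁).val.map d := by
    rw [← Multiset.map_cons, ← Multiset.map_cons]
    congr 1
    rw [Finset.erase_val, Multiset.cons_erase hi₁, Finset.erase_val,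
      Multiset.cons_erase (mem_univ_val _)]
  rw [sortedEigenvalues, hW, hm, Multiset.sort_cons, Multiset.sort_cons]
  · rfl
  · intro b hb
    obtain ⟨j, hj, rfl⟩ := Multiset.mem_map.1 hb
    rw [mem_val, mem_erase, mem_erase] at hj
    exact h j hj.2.1
  · intro b hb
    rcases Multiset.mem_cons.1 hb with rfl | hb
    · exact h01
    obtain ⟨j, hj, rfl⟩ := Multiset.mem_map.1 hb
    rw [mem_val, mem_erase, mem_erase] at hj
    exact (h j hj.2.1).trans h01

/-- Away from a given index, a family on a nontrivial finite type has a largest member. -/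
theorem exists_max_ne [Nontrivial ι] (d : ι → ℝ) (i₀ : ι) :
    ∃ i₁ ≠ i₀, ∀ j, j ≠ i₀ → d j ≤ d i₁ := by
  obtain ⟨x, hx⟩ := exists_ne i₀
  obtain ⟨i₁, hi₁, hmax⟩ := exists_max_image (univ.erase i₀) d ⟨x, by simp [hx]⟩
  exact ⟨i₁, (mem_erase.1 hi₁).1, fun j hj => hmax j (by simp [hj])⟩

end SecondEigenvalue

/-! ### Products with the walk on a complete graph -/

section Product

variable {ι β : Type*} [Fintype ι] [DecidableEq ι] [Fintype β] [DecidableEq β]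

/-- The walk on `β` that moves to a uniformly random different element. -/
noncomputable def moveMatrix (β : Type*) [Fintype β] [DecidableEq β] : Matrix β β ℝ :=
  Matrix.of fun b b' => if b = b' then 0 else ((Fintype.card β : ℝ) - 1)⁻¹

/-- The eigenvalues of `moveMatrix β` are `1`, once, and `-1 / (#β - 1)`: adding `1 / (#β - 1)` to
the diagonal leaves a matrix of rank one. -/
theorem exists_diagonalizedBy_moveMatrix (hβ : 2 ≤ Fintype.card β) :
    ∃ e b₀, DiagonalizedBy (moveMatrix β) e ∧ e b₀ = 1 ∧
      ∀ b, b ≠ b₀ → e b = -((Fintype.card β : ℝ) - 1)⁻¹ := by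
  have hm : (1 : ℝ) < Fintype.card β := by exact_mod_cast hβ
  have hm0 : (Fintype.card β : ℝ) - 1 ≠ 0 := by linarith
  set m : ℝ := ((Fintype.card β : ℝ) - 1)⁻¹
  have hmpos : 0 < m := inv_pos.2 (by linarith)
  have hsymm : (moveMatrix β).IsHermitian := by
    ext i j
    simp [moveMatrix, eq_comm]
  obtain ⟨e, he⟩ := exists_diagonalizedBy_of_isHermitian hsymm
  have : Nonempty β := Fintype.card_pos_iff.1 (by omega)
  obtain ⟨b₀, hb₀⟩ := he.exists_eq_of_mulVec (f := 1) (c := 1) one_ne_zero (by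
    ext b
    simp only [Matrix.mulVec, dotProduct, moveMatrix, Matrix.of_apply, Pi.one_apply, mul_one,
      one_smul]
    have : ∀ x, (if b = x then 0 else ((Fintype.card β : ℝ) - 1)⁻¹) =
        ((Fintype.card β : ℝ) - 1)⁻¹ - (if b = x then ((Fintype.card β : ℝ) - 1)⁻¹ else 0) := by
      intro x; split_ifs <;> simp
    simp only [this, sum_sub_distrib, sum_const, card_univ, nsmul_eq_mul, sum_ite_eq, mem_univ,
      if_true]
    field_simp)
  have hrank : (moveMatrix β - (-m) • 1).rank ≤ 1 := by
    have : moveMatrix β - (-m) • 1 = Matrix.vecMulVec (fun _ => m) (fun _ => (1 : ℝ)) := by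
      ext b b'
      by_cases hb : b = b' <;> simp [moveMatrix, Matrix.vecMulVec_apply, hb, m]
    rw [this]
    exact Matrix.rank_vecMulVec_le _ _
  rw [← he.card_ne_eq_rank] at hrank
  refine ⟨e, b₀, he, hb₀, fun b hb => ?_⟩
  by_contra hne
  refine hb (card_le_one.1 hrank b ?_ b₀ ?_)
  · simpa using hne
  · simp only [mem_filter, mem_univ, true_and, hb₀]
    linarith

open scoped Kronecker

/-- The second largest eigenvalue of a product with `moveMatrix β` is that of the first factor, if
`hneg` holds: the negative eigenvalue `-1 / (#β - 1)` of `moveMatrix β` must not turn a negative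
eigenvalue of the first factor into a larger one. -/
theorem sortedEigenvalues_kronecker_moveMatrix {U : Type*} [Fintype U] [DecidableEq U]
    {W : Matrix U U ℝ} {P : Matrix ι ι ℝ} {d : ι → ℝ} (hP : DiagonalizedBy P d)
    (hβ : 2 ≤ Fintype.card β)
    (hW : W.charpoly = (P ⊗ₖ moveMatrix β).charpoly) {i₀ i₁ : ι} (hi₀ : d i₀ = 1)
    (hne : i₁ ≠ i₀) (h1 : d i₁ ≤ 1) (h : ∀ j, j ≠ i₀ → d j ≤ d i₁)
    (hneg : ∀ j, -d j ≤ d i₁ * ((Fintype.card β : ℝ) - 1)) :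
    (sortedEigenvalues W).getD 1 0 = d i₁ := by
  obtain ⟨e, b₀, he, hb₀, hb⟩ := exists_diagonalizedBy_moveMatrix hβ
  have hm : (0 : ℝ) < (Fintype.card β : ℝ) - 1 := by
    have : (1 : ℝ) < Fintype.card β := by exact_mod_cast hβ
    linarith
  have hr := (hP.kronecker he).roots_charpoly
  rw [← hW] at hr
  have := sortedEigenvalues_getD_one hr (i₀ := (i₀, b₀)) (i₁ := (i₁, b₀)) (by simp [hne])
    (by simpa [hi₀, hb₀] using h1) (by
      rintro ⟨j, b⟩ hjb
      simp only [hb₀, mul_one]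
      by_cases hbb : b = b₀
      · subst hbb
        rw [hb₀, mul_one]
        exact h j fun hj => hjb (by rw [hj])
      · rw [hb b hbb, mul_neg, ← neg_mul, ← div_eq_mul_inv, div_le_iff₀ hm]
        exact hneg j)
  simpa [hb₀] using this

/-- The one-sided form of `sortedEigenvalues_kronecker_moveMatrix`: every bound `l` for the
eigenvalues of the first factor other than `1` that satisfies `hneg` bounds the second largest
eigenvalue of the product. -/
theorem sortedEigenvalues_kronecker_moveMatrix_le {U : Type*} [Fintype U] [DecidableEq U]
    {W : Matrix U U ℝ} {P : Matrix ι ι ℝ} {d : ι → ℝ} (hP : DiagonalizedBy P d)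
    (hβ : 2 ≤ Fintype.card β)
    (hW : W.charpoly = (P ⊗ₖ moveMatrix β).charpoly) {i₀ : ι} {l : ℝ} (hi₀ : d i₀ = 1)
    (h1 : l ≤ 1) (h : ∀ j, j ≠ i₀ → d j ≤ l)
    (hneg : ∀ j, -d j ≤ l * ((Fintype.card β : ℝ) - 1)) :
    (sortedEigenvalues W).getD 1 0 ≤ l := by
  obtain ⟨e, b₀, he, hb₀, hb⟩ := exists_diagonalizedBy_moveMatrix hβ
  have hm : (0 : ℝ) < (Fintype.card β : ℝ) - 1 := by
    have : (1 : ℝ) < Fintype.card β := by exact_mod_cast hβ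
    linarith
  have hr := (hP.kronecker he).roots_charpoly
  rw [← hW] at hr
  have hle : ∀ p : ι × β, p ≠ (i₀, b₀) → d p.1 * e p.2 ≤ l := by
    rintro ⟨j, b⟩ hjb
    by_cases hbb : b = b₀
    · subst hbb
      simp only [hb₀, mul_one]
      exact h j fun hj => hjb (by rw [hj])
    · simp only
      rw [hb b hbb, mul_neg, ← neg_mul, ← div_eq_mul_inv, div_le_iff₀ hm]
      exact hneg j
  have : Nontrivial β := Fintype.one_lt_card_iff_nontrivial.1 (by omega)
  have : Nonempty ι := ⟨i₀⟩
  obtain ⟨p, hp, hmax⟩ := exists_max_ne (fun p : ι × β => d p.1 * e p.2) (i₀, b₀)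
  rw [sortedEigenvalues_getD_one hr hp _ hmax]
  · exact hle p hp
  · simpa [hi₀, hb₀] using (hle p hp).trans h1

end Product

/-! ### The numbers in the weights -/

section Constants

/-- The Beta function `B(a, b) = (a - 1)! (b - 1)! / (a + b - 1)!` at positive integers. -/
noncomputable def natBeta (a b : ℕ) : ℝ :=
  ((a - 1).factorial * (b - 1).factorial : ℝ) / ((a + b - 1).factorial : ℝ)

theorem natBeta_succ_left {a b : ℕ} (ha : 1 ≤ a) (hb : 1 ≤ b) :
    natBeta (a + 1) b = a / (a + b) * natBeta a b := by
  obtain ⟨a, rfl⟩ := Nat.exists_eq_add_of_le' ha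
  obtain ⟨b, rfl⟩ := Nat.exists_eq_add_of_le' hb
  have h1 : a + 1 + 1 + (b + 1) - 1 = (a + b + 1) + 1 := by omega
  have h2 : a + 1 + (b + 1) - 1 = a + b + 1 := by omega
  have h3 : ((a + b + 1).factorial : ℝ) ≠ 0 := by positivity
  have h4 : (a : ℝ) + 1 + (b + 1) ≠ 0 := by positivity
  simp only [natBeta, h1, h2, Nat.add_sub_cancel, Nat.factorial_succ a,
    Nat.factorial_succ (a + b + 1)]
  push_cast
  have h5 : (a : ℝ) + b + 1 + 1 ≠ 0 := by positivity
  field_simp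
  ring

theorem natBeta_comm (a b : ℕ) : natBeta a b = natBeta b a := by
  rw [natBeta, natBeta, mul_comm, add_comm]

theorem natBeta_succ_right {a b : ℕ} (ha : 1 ≤ a) (hb : 1 ≤ b) :
    natBeta a (b + 1) = b / (a + b) * natBeta a b := by
  rw [natBeta_comm, natBeta_succ_left hb ha, natBeta_comm, add_comm (b : ℝ)]

theorem natBeta_pos (a b : ℕ) : 0 < natBeta a b := by
  unfold natBeta; positivity

/-- The recursion that makes the weights of the faces over an edge balanced. -/
theorem natBeta_succ_add {a b : ℕ} (ha : 1 ≤ a) (hb : 1 ≤ b) :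
    natBeta (a + 1) b + natBeta a (b + 1) = natBeta a b := by
  rw [natBeta_succ_left ha hb, natBeta_succ_right ha hb, ← add_mul, ← add_div, div_self, one_mul]
  positivity

theorem natBeta_one {a : ℕ} (ha : 1 ≤ a) : natBeta a 1 = 1 / a := by
  obtain ⟨a, rfl⟩ := Nat.exists_eq_add_of_le' ha
  have h3 : (a.factorial : ℝ) ≠ 0 := by positivity
  simp only [natBeta, Nat.add_sub_cancel, Nat.factorial_succ]
  push_cast
  field_simp
  simp

/-- The reciprocal of a binomial coefficient is a value of the Beta function. -/
theorem one_div_choose_eq_natBeta {H a b : ℕ} (ha : 1 ≤ a) (hb : 1 ≤ b) (hab : a + b = H + 1) :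
    1 / ((H - 1).choose (a - 1) : ℝ) = H * natBeta a b := by
  obtain ⟨a, rfl⟩ := Nat.exists_eq_add_of_le' ha
  obtain ⟨b, rfl⟩ := Nat.exists_eq_add_of_le' hb
  obtain rfl : H = a + b + 1 := by omega
  have h2 : a + 1 + (b + 1) - 1 = a + b + 1 := by omega
  simp only [natBeta, h2, Nat.add_sub_cancel, Nat.factorial_succ (a + b)]
  rw [Nat.choose_symm_add, Nat.add_choose, Nat.cast_div (Nat.factorial_mul_factorial_dvd_factorial_add a b)
    (by positivity)]
  push_cast
  have h3 : ((a + b).factorial : ℝ) ≠ 0 := by positivity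
  field_simp

/-- The tail `1/t + ⋯ + 1/H` of the harmonic sum. -/
noncomputable def harmonicTail (H t : ℕ) : ℝ := ∑ q ∈ Ico t (H + 1), 1 / (q : ℝ)

theorem harmonicTail_eq {H t : ℕ} (ht : t ≤ H) :
    harmonicTail H t = 1 / (t : ℝ) + harmonicTail H (t + 1) :=
  sum_eq_sum_Ico_succ_bot (Nat.lt_succ_of_le ht) _

theorem harmonicTail_nonneg (H t : ℕ) : 0 ≤ harmonicTail H t :=
  sum_nonneg fun _ _ => by positivity

theorem harmonicTail_top (H : ℕ) : harmonicTail H (H + 1) = 0 := by simp [harmonicTail]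

/-- The common factor of the weights of all faces with `t` elements: `H` times the number of ways
to choose further colours, one after the other, up to `H + 1` colours out of `s`. -/
noncomputable def colorFactor (H s t : ℕ) : ℝ := H * ∏ q ∈ Ico t (H + 1), ((s : ℝ) - q)

theorem colorFactor_eq {H s t : ℕ} (ht : t ≤ H) :
    colorFactor H s t = ((s : ℝ) - t) * colorFactor H s (t + 1) := by
  rw [colorFactor, prod_eq_prod_Ico_succ_bot (Nat.lt_succ_of_le ht), colorFactor]
  ring

theorem colorFactor_pos {H s : ℕ} (hH : 1 ≤ H) (hs : H + 1 ≤ s) (t : ℕ) :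
    0 < colorFactor H s t := by
  refine mul_pos (by exact_mod_cast hH) (prod_pos fun q hq => ?_)
  have : q < s := by have := (mem_Ico.1 hq).2; omega
  exact sub_pos.2 (by exact_mod_cast this)

theorem colorFactor_top (H s : ℕ) : colorFactor H s (H + 1) = H := by simp [colorFactor]

end Constants

/-! ### Faces of the product complex and their weights -/

namespace WeightedGraph

variable {V : Type*}

theorem adjMatrix_of_adj (G : WeightedGraph V) {u v : V} (h : G.graph.Adj u v) :
    G.adjMatrix u v = G.weight s(u, v) := by
  simp [adjMatrix, h]

theorem adjMatrix_of_not_adj (G : WeightedGraph V) {u v : V} (h : ¬ G.graph.Adj u v) :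
    G.adjMatrix u v = 0 := by
  simp [adjMatrix, h]

theorem adjMatrix_isSymm (G : WeightedGraph V) : G.adjMatrix.IsSymm := by
  ext u v
  rw [Matrix.transpose_apply]
  by_cases h : G.graph.Adj u v
  · rw [G.adjMatrix_of_adj h, G.adjMatrix_of_adj h.symm, Sym2.eq_swap]
  · rw [G.adjMatrix_of_not_adj h, G.adjMatrix_of_not_adj (mt SimpleGraph.Adj.symm h)]

section Faces

theorem notMem_of_snd_notMem {s : ℕ} {τ : Finset (V × Fin s)} {z : V} {b : Fin s}
    (hb : b ∉ τ.image Prod.snd) : (z, b) ∉ τ :=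
  fun h => hb (mem_image_of_mem Prod.snd h)

theorem card_compl_image_snd {s : ℕ} {τ : Finset (V × Fin s)}
    (hinj : Set.InjOn Prod.snd (τ : Set (V × Fin s))) :
    (#(τ.image Prod.snd)ᶜ : ℝ) = (s : ℝ) - #τ := by
  rw [card_compl, card_image_of_injOn hinj, Fintype.card_fin, Nat.cast_sub]
  have := card_le_univ (τ.image Prod.snd)
  rwa [card_image_of_injOn hinj, Fintype.card_fin] at this

variable [DecidableEq V] (G : WeightedGraph V) {H s : ℕ}

theorem injOn_snd_insert {τ : Finset (V × Fin s)} (h : Set.InjOn Prod.snd (τ : Set (V × Fin s)))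
    {z : V} {b : Fin s} (hb : b ∉ τ.image Prod.snd) :
    Set.InjOn Prod.snd ((insert (z, b) τ : Finset (V × Fin s)) : Set (V × Fin s)) := by
  rw [coe_insert, Set.injOn_insert]
  · refine ⟨h, ?_⟩
    simpa using hb
  · intro hx
    exact hb (mem_image_of_mem Prod.snd (mem_coe.1 hx))

theorem card_filter_pos {τ : Finset (V × Fin s)} {u : V} (hu : u ∈ τ.image Prod.fst) :
    1 ≤ #{x ∈ τ | x.1 = u} := by
  obtain ⟨x, hx, rfl⟩ := mem_image.1 hu
  exact card_pos.2 ⟨x, by simp [hx]⟩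

theorem card_filter_add_card_filter {τ : Finset (V × Fin s)} {u v : V} (huv : u ≠ v)
    (h : τ.image Prod.fst ⊆ {u, v}) : #{x ∈ τ | x.1 = u} + #{x ∈ τ | x.1 = v} = #τ := by
  rw [← card_union_of_disjoint]
  · congr 1
    ext x
    simp only [mem_union, mem_filter]
    refine ⟨fun hx => hx.elim And.left And.left, fun hx => ?_⟩
    have : x.1 ∈ ({u, v} : Finset V) := h (mem_image_of_mem _ hx)
    simp only [mem_insert, mem_singleton] at this
    exact this.imp (⟨hx, ·⟩) (⟨hx, ·⟩)
  · rw [disjoint_filter]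
    intro x _ hx hx'
    exact huv (hx.symm.trans hx')

theorem card_filter_of_image_eq {τ : Finset (V × Fin s)} {u : V}
    (h : τ.image Prod.fst = {u}) : #{x ∈ τ | x.1 = u} = #τ := by
  rw [filter_true_of_mem]
  intro x hx
  simpa [h] using mem_image_of_mem Prod.fst hx

theorem card_filter_insert_self {τ : Finset (V × Fin s)} {u : V} {b : Fin s}
    (hb : b ∉ τ.image Prod.snd) :
    #{x ∈ insert (u, b) τ | x.1 = u} = #{x ∈ τ | x.1 = u} + 1 := by
  rw [filter_insert, if_pos rfl, card_insert_of_notMem]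
  simp [notMem_of_snd_notMem hb]

theorem card_filter_insert_of_ne {τ : Finset (V × Fin s)} {u z : V} {b : Fin s} (hz : z ≠ u) :
    #{x ∈ insert (z, b) τ | x.1 = u} = #{x ∈ τ | x.1 = u} := by
  rw [filter_insert, if_neg hz]

theorem pair_eq_of_pair_subset {u v u' v' : V} (huv : u ≠ v)
    (h : ({u, v} : Finset V) ⊆ {u', v'}) : ({u, v} : Finset V) = {u', v'} :=
  eq_of_subset_of_card_le h (by rw [card_pair huv]; exact card_le_two)

variable [Fintype V]

theorem mem_productComplex_faces {σ : Finset (V × Fin s)} :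
    σ ∈ (G.productComplex H s).faces ↔ ∃ τ ∈ G.productTopFaces H s, σ ⊆ τ := by
  simp [productComplex]

theorem mem_productTopFaces {σ : Finset (V × Fin s)} :
    σ ∈ G.productTopFaces H s ↔ #σ = H + 1 ∧
      (∃ u v, G.graph.Adj u v ∧ σ.image Prod.fst = {u, v}) ∧
      Set.InjOn Prod.snd (σ : Set (V × Fin s)) := by
  simp [productTopFaces]

variable {G}

theorem injOn_of_mem_faces {σ : Finset (V × Fin s)} (h : σ ∈ (G.productComplex H s).faces) :
    Set.InjOn Prod.snd (σ : Set (V × Fin s)) := by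
  obtain ⟨τ, hτ, hστ⟩ := G.mem_productComplex_faces.1 h
  exact (G.mem_productTopFaces.1 hτ).2.2.mono (by exact_mod_cast hστ)

theorem exists_adj_of_mem_faces {σ : Finset (V × Fin s)}
    (h : σ ∈ (G.productComplex H s).faces) :
    ∃ u v, G.graph.Adj u v ∧ σ.image Prod.fst ⊆ {u, v} := by
  obtain ⟨τ, hτ, hστ⟩ := G.mem_productComplex_faces.1 h
  obtain ⟨u, v, huv, hI⟩ := (G.mem_productTopFaces.1 hτ).2.1
  exact ⟨u, v, huv, hI ▸ image_subset_image hστ⟩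

theorem mem_faces_of_image_eq_pair (hs : H + 1 ≤ s) {σ : Finset (V × Fin s)}
    (hinj : Set.InjOn Prod.snd (σ : Set (V × Fin s))) (hσ : #σ ≤ H + 1) {u v : V}
    (huv : G.graph.Adj u v) (hI : σ.image Prod.fst = {u, v}) :
    σ ∈ (G.productComplex H s).faces := by
  obtain ⟨i, hi⟩ := Nat.exists_eq_add_of_le hσ
  induction i generalizing σ with
  | zero =>
    exact G.mem_productComplex_faces.2
      ⟨σ, G.mem_productTopFaces.2 ⟨hi.symm, ⟨u, v, huv, hI⟩, hinj⟩, Subset.rfl⟩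
  | succ i ih =>
    obtain ⟨b, hb⟩ : ∃ b, b ∉ σ.image Prod.snd := by
      by_contra! hall
      have h1 : #(univ : Finset (Fin s)) ≤ #(σ.image Prod.snd) :=
        card_le_card fun b _ => hall b
      have h2 : #(σ.image Prod.snd) ≤ #σ := card_image_le
      rw [card_univ, Fintype.card_fin] at h1
      omega
    have hc : #(insert (u, b) σ) = #σ + 1 := card_insert_of_notMem (notMem_of_snd_notMem hb)
    refine (G.productComplex H s).down_closed _
      (ih (injOn_snd_insert hinj hb) (by omega) ?_ (by omega)) _ (subset_insert (u, b) σ)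
    rw [image_insert, hI]
    simp

theorem mem_faces_of_image_subset_singleton (hs : H + 1 ≤ s) {σ : Finset (V × Fin s)}
    (hinj : Set.InjOn Prod.snd (σ : Set (V × Fin s))) (hσ : #σ ≤ H) {u v : V}
    (huv : G.graph.Adj u v) (hI : σ.image Prod.fst = {u}) :
    σ ∈ (G.productComplex H s).faces := by
  obtain ⟨b, hb⟩ : ∃ b, b ∉ σ.image Prod.snd := by
    by_contra! hall
    have h1 : #(univ : Finset (Fin s)) ≤ #(σ.image Prod.snd) := card_le_card fun b _ => hall b
    have h2 : #(σ.image Prod.snd) ≤ #σ := card_image_le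
    rw [card_univ, Fintype.card_fin] at h1
    omega
  have hc : #(insert (v, b) σ) = #σ + 1 := card_insert_of_notMem (notMem_of_snd_notMem hb)
  refine (G.productComplex H s).down_closed _ (mem_faces_of_image_eq_pair hs
    (injOn_snd_insert hinj hb) (by omega) huv.symm ?_) _ (subset_insert (v, b) σ)
  rw [image_insert, hI]

variable (G H)

/-- The weight of a set in the product complex, extended by `0` to the sets that are not faces. -/
noncomputable def faceValue (τ : Finset (V × Fin s)) : ℝ :=
  if τ ∈ (G.productComplex H s).faces then (G.productComplex H s).weight τ else 0

variable {G H}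

theorem faceValue_of_forall_not_subset {τ : Finset (V × Fin s)}
    (h : ∀ u v, G.graph.Adj u v → ¬ τ.image Prod.fst ⊆ {u, v}) : G.faceValue H τ = 0 := by
  rw [faceValue, if_neg]
  intro hτ
  obtain ⟨u, v, huv, hI⟩ := exists_adj_of_mem_faces hτ
  exact h u v huv hI

/-- The balance condition, which holds for `faceValue` at nonfaces too. The sum is written over
the elements with an unused colour. -/
theorem faceValue_eq_sum {τ : Finset (V × Fin s)} (hτ : #τ ≤ H) :
    G.faceValue H τ =
      ∑ b ∈ (τ.image Prod.snd)ᶜ, ∑ z, G.faceValue H (insert (z, b) τ) := by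
  set X := G.productComplex H s
  by_cases hF : τ ∈ X.faces
  · have hbal := G.productComplex_isBalanced H s ((#τ : ℤ) - 1) (by omega) (by omega) τ
      (by simp [WeightedComplex.facesOfDim, hF, X])
    rw [faceValue, if_pos hF, hbal]
    refine Eq.trans ?_
      (sum_product_right univ _ fun x : V × Fin s => G.faceValue H (insert x τ))
    rw [← sum_filter_add_sum_filter_not _ (fun x : V × Fin s => insert x τ ∈ X.faces)]
    rw [sum_eq_zero (s := {x ∈ _ | ¬ insert x τ ∈ X.faces}), add_zero]
    swap
    · rintro ⟨z, b⟩ hx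
      exact if_neg (mem_filter.1 hx).2
    symm
    refine sum_bij (fun x _ => insert x τ) ?_ ?_ ?_ ?_
    · rintro ⟨z, b⟩ hx
      simp only [mem_filter, mem_product, mem_univ, true_and, mem_compl] at hx
      have hc : #(insert (z, b) τ) = #τ + 1 := card_insert_of_notMem (notMem_of_snd_notMem hx.1)
      simp only [WeightedComplex.facesOfDim, mem_filter]
      refine ⟨⟨hx.2, by omega⟩, subset_insert _ _⟩
    · rintro ⟨z, b⟩ hx ⟨z', b'⟩ hx' heq
      simp only [mem_filter, mem_product, mem_univ, true_and, mem_compl] at hx hx'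
      have h1 : (z, b) ∈ insert (z', b') τ := heq ▸ mem_insert_self _ _
      exact (mem_insert.1 h1).resolve_right (notMem_of_snd_notMem hx.1)
    · intro ρ hρ
      simp only [WeightedComplex.facesOfDim, mem_filter] at hρ
      obtain ⟨⟨hρF, hρc⟩, hsub⟩ := hρ
      obtain ⟨x, hx⟩ : ∃ x, ρ \ τ = {x} := by
        rw [← card_eq_one, card_sdiff_of_subset hsub]; omega
      have hxρ : x ∈ ρ \ τ := hx ▸ mem_singleton_self x
      have hins : insert x τ = ρ := by
        rw [insert_eq, ← hx, sdiff_union_of_subset hsub]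
      refine ⟨x, ?_, hins⟩
      simp only [mem_filter, mem_product, mem_univ, true_and, mem_compl]
      refine ⟨fun hmem => ?_, hins ▸ hρF⟩
      obtain ⟨y, hy, hyx⟩ := mem_image.1 hmem
      have := injOn_of_mem_faces hρF (hsub hy) (mem_sdiff.1 hxρ).1 hyx
      exact (mem_sdiff.1 hxρ).2 (this ▸ hy)
    · rintro ⟨z, b⟩ hx
      exact if_pos (mem_filter.1 hx).2
  · rw [faceValue, if_neg hF, sum_eq_zero]
    intro b _
    refine sum_eq_zero fun z _ => if_neg fun h => hF ?_
    exact X.down_closed _ h _ (subset_insert _ _)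

/-- Weights of the faces that meet both fibres over an edge. By downward induction on the number of
elements: the top faces are `one_div_choose_eq_natBeta`, the step is `natBeta_succ_add`. -/
theorem faceValue_of_image_eq_pair (hs : H + 1 ≤ s) {τ : Finset (V × Fin s)}
    (hinj : Set.InjOn Prod.snd (τ : Set (V × Fin s))) (hτ : #τ ≤ H + 1) {u v : V}
    (huv : G.graph.Adj u v) (hI : τ.image Prod.fst = {u, v}) :
    G.faceValue H τ = colorFactor H s #τ *
      (G.adjMatrix u v * natBeta #{x ∈ τ | x.1 = u} #{x ∈ τ | x.1 = v}) := by
  obtain ⟨i, hi⟩ := Nat.exists_eq_add_of_le hτ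
  induction i generalizing τ with
  | zero =>
    have hc : #τ = H + 1 := hi.symm
    have hadd := card_filter_add_card_filter huv.ne hI.subset
    rw [faceValue, if_pos (mem_faces_of_image_eq_pair hs hinj hτ huv hI),
      G.productComplex_weight_top H s (G.mem_productTopFaces.2 ⟨hc, ⟨u, v, huv, hI⟩, hinj⟩),
      G.productTopWeight_eq H s hc huv hI, hc, colorFactor_top, G.adjMatrix_of_adj huv,
      div_eq_mul_one_div, one_div_choose_eq_natBeta (card_filter_pos (by simp [hI]))
        (card_filter_pos (by simp [hI])) (hadd.trans hc)]
    ring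
  | succ i ih =>
    have hH : #τ ≤ H := by omega
    have key : ∀ b ∈ (τ.image Prod.snd)ᶜ, ∑ z, G.faceValue H (insert (z, b) τ) =
        colorFactor H s (#τ + 1) *
          (G.adjMatrix u v * natBeta #{x ∈ τ | x.1 = u} #{x ∈ τ | x.1 = v}) := by
      intro b hb
      rw [mem_compl] at hb
      have hc : ∀ z, #(insert (z, b) τ) = #τ + 1 := fun z =>
        card_insert_of_notMem (notMem_of_snd_notMem hb)
      have hIz : ∀ z, (insert (z, b) τ).image Prod.fst = insert z {u, v} := fun z => by
        rw [image_insert, hI]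
      have hu := ih (τ := insert (u, b) τ) (injOn_snd_insert hinj hb) (by rw [hc]; omega)
        (by rw [hIz]; simp) (by rw [hc]; omega)
      have hv := ih (τ := insert (v, b) τ) (injOn_snd_insert hinj hb) (by rw [hc]; omega)
        (by rw [hIz]; simp) (by rw [hc]; omega)
      rw [hc, card_filter_insert_self hb, card_filter_insert_of_ne huv.ne] at hu
      rw [hc, card_filter_insert_self hb, card_filter_insert_of_ne huv.ne'] at hv
      rw [← sum_subset (subset_univ {u, v}), sum_pair huv.ne, hu, hv, ← mul_add, ← mul_add,
        natBeta_succ_add (card_filter_pos (by simp [hI])) (card_filter_pos (by simp [hI]))]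
      intro z _ hz
      refine faceValue_of_forall_not_subset fun u' v' _ hsub => hz ?_
      rw [hIz] at hsub
      rw [pair_eq_of_pair_subset huv.ne ((subset_insert z _).trans hsub)]
      exact hsub (mem_insert_self _ _)
    rw [faceValue_eq_sum hH, sum_congr rfl key, sum_const, nsmul_eq_mul,
      card_compl_image_snd hinj, colorFactor_eq hH]
    ring

/-- Weights of the faces inside one fibre. By downward induction: adding an element over a neighbour
of `u` gives `B(t, 1) = 1 / t`, the term by which the harmonic tail grows. At `#τ = H + 1` the set is
not a face, and both sides vanish. -/
theorem faceValue_of_image_eq_singleton (hs : H + 1 ≤ s) {τ : Finset (V × Fin s)}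
    (hinj : Set.InjOn Prod.snd (τ : Set (V × Fin s))) (hτ : #τ ≤ H + 1) {u : V}
    (hI : τ.image Prod.fst = {u}) :
    G.faceValue H τ = colorFactor H s #τ * (G.degree u * harmonicTail H #τ) := by
  obtain ⟨i, hi⟩ := Nat.exists_eq_add_of_le hτ
  induction i generalizing τ with
  | zero =>
    have hc : #τ = H + 1 := hi.symm
    rw [faceValue, if_neg, hc, harmonicTail_top, mul_zero, mul_zero]
    intro hF
    obtain ⟨τ', hτ', hsub⟩ := G.mem_productComplex_faces.1 hF
    obtain ⟨hc', ⟨u', v', huv, hI'⟩, -⟩ := G.mem_productTopFaces.1 hτ'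
    rw [← eq_of_subset_of_card_le hsub (by omega), hI] at hI'
    have := congrArg card hI'
    rw [card_singleton, card_pair huv.ne] at this
    omega
  | succ i ih =>
    have hH : #τ ≤ H := by omega
    have hpos : 1 ≤ #τ := by
      rw [← card_filter_of_image_eq hI]
      exact card_filter_pos (by simp [hI])
    have key : ∀ b ∈ (τ.image Prod.snd)ᶜ, ∑ z, G.faceValue H (insert (z, b) τ) =
        colorFactor H s (#τ + 1) * (G.degree u * harmonicTail H #τ) := by
      intro b hb
      rw [mem_compl] at hb
      have hc : ∀ z, #(insert (z, b) τ) = #τ + 1 := fun z =>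
        card_insert_of_notMem (notMem_of_snd_notMem hb)
      have hIz : ∀ z, (insert (z, b) τ).image Prod.fst = {z, u} := fun z => by
        rw [image_insert, hI]
      have hu := ih (τ := insert (u, b) τ) (injOn_snd_insert hinj hb) (by rw [hc]; omega)
        (by rw [hIz]; simp) (by rw [hc]; omega)
      have hval : ∀ z, G.faceValue H (insert (z, b) τ) =
          (if z = u then colorFactor H s (#τ + 1) * (G.degree u * harmonicTail H (#τ + 1)) else 0) +
            colorFactor H s (#τ + 1) * (G.adjMatrix u z * natBeta #τ 1) := by
        intro z
        by_cases hzu : z = u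
        · subst hzu
          rw [hu, hc, if_pos rfl, G.adjMatrix_of_not_adj (G.graph.loopless.irrefl z)]
          ring
        rw [if_neg hzu, zero_add]
        by_cases hadj : G.graph.Adj u z
        · rw [faceValue_of_image_eq_pair hs (injOn_snd_insert hinj hb) (by rw [hc]; omega) hadj
            (by rw [hIz, pair_comm]), hc, card_filter_insert_self hb, card_filter_insert_of_ne hzu,
            card_filter_of_image_eq hI, filter_false_of_mem, card_empty]
          intro x hx hxz
          have : x.1 ∈ τ.image Prod.fst := mem_image_of_mem _ hx
          rw [hI, mem_singleton] at this
          exact hzu (hxz.symm.trans this)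
        · rw [G.adjMatrix_of_not_adj hadj, zero_mul, mul_zero]
          refine faceValue_of_forall_not_subset fun u' v' huv' hsub => hadj ?_
          rw [hIz] at hsub
          have heq := pair_eq_of_pair_subset hzu hsub
          have h1 : u' ∈ ({z, u} : Finset V) := heq ▸ mem_insert_self _ _
          have h2 : v' ∈ ({z, u} : Finset V) := heq ▸ (by simp)
          simp only [mem_insert, mem_singleton] at h1 h2
          rcases h1 with rfl | rfl <;> rcases h2 with rfl | rfl
          · exact absurd rfl huv'.ne
          · exact huv'.symm
          · exact huv'
          · exact absurd rfl huv'.ne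
      simp only [hval, sum_add_distrib, sum_ite_eq', mem_univ, if_true, ← mul_sum, ← sum_mul]
      rw [natBeta_one hpos, harmonicTail_eq hH, degree]
      ring
    rw [faceValue_eq_sum hH, sum_congr rfl key, sum_const, nsmul_eq_mul,
      card_compl_image_snd hinj, colorFactor_eq hH]
    ring

end Faces

end WeightedGraph

/-! ### The random walk on a link -/

open scoped Kronecker in
/-- If the adjacency matrix of a weighted graph is `N ⊗ (J - I)`, then its random walk is the
product of the walk `N D⁻¹` with `moveMatrix`. -/
theorem WeightedGraph.charpoly_walkMatrix_eq_kronecker {U ι β : Type*} [Fintype U] [DecidableEq U]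
    [Fintype ι] [DecidableEq ι] [Fintype β] [DecidableEq β] (Γ : WeightedGraph U)
    (e : ι × β ≃ U) {N : Matrix ι ι ℝ} {D : ι → ℝ} (hND : ∀ i, ∑ j, N i j = D i)
    (h : ∀ p q, Γ.adjMatrix (e p) (e q) = if p.2 = q.2 then 0 else N p.1 q.1) :
    Γ.walkMatrix.charpoly =
      ((N * Matrix.diagonal fun i => (D i)⁻¹) ⊗ₖ moveMatrix β).charpoly := by
  have hdeg : ∀ p, Γ.degree (e p) = ((Fintype.card β : ℝ) - 1) * D p.1 := by
    intro p
    rw [degree, ← Equiv.sum_comp e, Fintype.sum_prod_type_right]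
    simp only [h]
    rw [← add_sum_erase _ _ (mem_univ p.2)]
    simp only [if_true, sum_const_zero, zero_add]
    rw [sum_congr rfl (g := fun _ => D p.1), sum_const, card_erase_of_mem (mem_univ _), card_univ,
      nsmul_eq_mul, Nat.cast_sub, Nat.cast_one]
    · exact Fintype.card_pos_iff.2 ⟨p.2⟩
    · intro b hb
      simp only [(ne_of_mem_erase hb).symm, if_false, hND]
  rw [← Matrix.charpoly_reindex e]
  congr 1
  ext x y
  obtain ⟨p, rfl⟩ := e.surjective x
  obtain ⟨q, rfl⟩ := e.surjective y
  rw [Matrix.reindex_apply, Matrix.submatrix_apply, e.symm_apply_apply, e.symm_apply_apply,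
    Matrix.kroneckerMap_apply, walkMatrix, Matrix.mul_diagonal, Matrix.mul_diagonal, h, hdeg,
    moveMatrix, Matrix.of_apply]
  split_ifs
  · simp
  · rw [mul_inv]; ring

namespace WeightedComplex

variable {α : Type*} [DecidableEq α] (X : WeightedComplex α)

theorem mem_link_faces {σ ρ : Finset α} :
    ρ ∈ (X.link σ).faces ↔ Disjoint ρ σ ∧ ρ ∪ σ ∈ X.faces := by
  simp only [link, mem_image, mem_filter]
  constructor
  · rintro ⟨τ, ⟨hτ, hστ⟩, rfl⟩
    exact ⟨sdiff_disjoint, by rwa [sdiff_union_of_subset hστ]⟩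
  · rintro ⟨hd, h⟩
    exact ⟨ρ ∪ σ, ⟨h, subset_union_right⟩, by rw [union_sdiff_right, sdiff_eq_self_of_disjoint hd]⟩

end WeightedComplex

namespace WeightedGraph

theorem card_unused {V : Type*} {s : ℕ} {σ : Finset (V × Fin s)}
    (hinj : Set.InjOn Prod.snd (σ : Set (V × Fin s))) :
    Fintype.card {b : Fin s // b ∉ σ.image Prod.snd} = s - #σ := by
  rw [Fintype.card_subtype_compl, Fintype.card_fin, Fintype.card_coe, card_image_of_injOn hinj]

variable {V : Type*} [DecidableEq V] [Fintype V] {G : WeightedGraph V} {H s : ℕ}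

theorem singleton_mem_link_faces {σ : Finset (V × Fin s)} {x : V × Fin s} :
    {x} ∈ ((G.productComplex H s).link σ).faces ↔
      x.2 ∉ σ.image Prod.snd ∧ insert x σ ∈ (G.productComplex H s).faces := by
  rw [WeightedComplex.mem_link_faces, disjoint_singleton_left, ← insert_eq]
  refine and_congr_left fun hF => ⟨fun hx hmem => hx ?_, fun hx hmem => hx ?_⟩
  · obtain ⟨y, hy, hyx⟩ := mem_image.1 hmem
    have := injOn_of_mem_faces hF (mem_insert_of_mem hy) (mem_insert_self x σ) hyx
    exact this ▸ hy
  · exact mem_image_of_mem _ hmem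

theorem adjMatrix_link_skeleton {σ : Finset (V × Fin s)}
    (x y : ((G.productComplex H s).link σ).Vertex) :
    ((G.productComplex H s).link σ).skeleton.adjMatrix x y =
      if x.1.2 = y.1.2 then 0 else G.faceValue H (insert x.1 (insert y.1 σ)) := by
  have hx : x.1 ∉ σ := by
    simpa using ((G.productComplex H s).mem_link_faces.1 x.2).1
  have hy : y.1 ∉ σ := by
    simpa using ((G.productComplex H s).mem_link_faces.1 y.2).1
  have hset : ({x.1, y.1} : Finset (V × Fin s)) ∪ σ = insert x.1 (insert y.1 σ) := by
    rw [insert_union, ← insert_eq]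
  have hmem : ({x.1, y.1} : Finset (V × Fin s)) ∈ ((G.productComplex H s).link σ).faces ↔
      insert x.1 (insert y.1 σ) ∈ (G.productComplex H s).faces := by
    rw [WeightedComplex.mem_link_faces, hset, and_iff_right]
    simp [hx, hy]
  have hadj : ((G.productComplex H s).link σ).skeleton.graph.Adj x y ↔
      x ≠ y ∧ insert x.1 (insert y.1 σ) ∈ (G.productComplex H s).faces := by
    simp only [WeightedComplex.skeleton, SimpleGraph.fromRel_adj]
    rw [pair_comm y.1 x.1, or_self, hmem]
  by_cases h2 : x.1.2 = y.1.2
  · rw [if_pos h2, adjMatrix_of_not_adj]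
    rw [hadj]
    rintro ⟨hne, hF⟩
    exact hne (Subtype.ext (injOn_of_mem_faces hF (mem_insert_self _ _)
      (mem_insert_of_mem (mem_insert_self _ _)) h2))
  · rw [if_neg h2, faceValue]
    have hne : x ≠ y := fun h => h2 (by rw [h])
    split_ifs with hF
    · rw [adjMatrix_of_adj _ (hadj.2 ⟨hne, hF⟩), ← hset]
      exact congrArg (fun ρ => (G.productComplex H s).weight (ρ ∪ σ)) Sym2.toFinset_mk_eq
    · rw [adjMatrix_of_not_adj]
      exact fun h => hF (hadj.1 h).2

open scoped Kronecker in
/-- The walk on the 1-skeleton of a link: the vertices of the link are the pairs of one of the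
vertices `g i` and an unused colour, and the weight of an edge depends on its colours only in that
these have to be different. -/
theorem charpoly_walkMatrix_link {ι : Type*} [Fintype ι] [DecidableEq ι]
    {σ : Finset (V × Fin s)} {g : ι → V} (hg : Function.Injective g)
    (hmem : ∀ z b, b ∉ σ.image Prod.snd →
      (insert (z, b) σ ∈ (G.productComplex H s).faces ↔ ∃ i, g i = z))
    {N : Matrix ι ι ℝ} {D : ι → ℝ} (hND : ∀ i, ∑ j, N i j = D i)
    (hN : ∀ i j b b', b ∉ σ.image Prod.snd → b' ∉ σ.image Prod.snd → b ≠ b' →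
      G.faceValue H (insert (g i, b) (insert (g j, b') σ)) = N i j) :
    ((G.productComplex H s).link σ).skeleton.walkMatrix.charpoly =
      ((N * Matrix.diagonal fun i => (D i)⁻¹) ⊗ₖ
        moveMatrix {b : Fin s // b ∉ σ.image Prod.snd}).charpoly := by
  let f : ι × {b : Fin s // b ∉ σ.image Prod.snd} → ((G.productComplex H s).link σ).Vertex :=
    fun p => ⟨(g p.1, p.2.1),
      singleton_mem_link_faces.2 ⟨p.2.2, (hmem _ _ p.2.2).2 ⟨p.1, rfl⟩⟩⟩
  have hf : Function.Bijective f := by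
    constructor
    · rintro ⟨i, b⟩ ⟨i', b'⟩ h
      have h1 := congrArg Subtype.val h
      simp only [f, Prod.mk.injEq] at h1
      exact Prod.ext (hg h1.1) (Subtype.ext h1.2)
    · rintro ⟨⟨z, b⟩, hx⟩
      obtain ⟨hb, hF⟩ := singleton_mem_link_faces.1 hx
      obtain ⟨i, rfl⟩ := (hmem z b hb).1 hF
      exact ⟨(i, ⟨b, hb⟩), rfl⟩
  refine charpoly_walkMatrix_eq_kronecker _ (Equiv.ofBijective f hf) hND fun p q => ?_
  rw [adjMatrix_link_skeleton]
  simp only [Equiv.ofBijective_apply, f, ← Subtype.ext_iff]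
  split_ifs with h
  · rfl
  · exact hN _ _ _ _ p.2.2 q.2.2 fun h' => h (Subtype.ext h')

end WeightedGraph

open scoped Kronecker in
/-- The second eigenvalue for the link of a face with `t ≥ 1` elements: the first factor has the
eigenvalues `1`, `μ` and, `n - 2` times, `1 / (t + 1)`, where `μ` is read off from the trace. If
`n = 2` and `μ < 1 / (t + 1)`, only the upper bound remains. -/
theorem second_eigenvalue_of_rank_le_two {U ι β : Type*} [Fintype U] [DecidableEq U] [Fintype ι]
    [DecidableEq ι] [Fintype β] [DecidableEq β] {W : Matrix U U ℝ} {N : Matrix ι ι ℝ} {D : ι → ℝ}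
    (hN : N.IsSymm) (hD : ∀ i, 0 < D i) (hND : ∀ i, ∑ j, N i j = D i)
    (hW : W.charpoly = ((N * Matrix.diagonal fun i => (D i)⁻¹) ⊗ₖ moveMatrix β).charpoly)
    {t : ℕ} (ht : 1 ≤ t) (hβ : t + 1 ≤ Fintype.card β) (hι : 2 ≤ Fintype.card ι)
    (hrank : ((N * Matrix.diagonal fun i => (D i)⁻¹) - (1 / ((t : ℝ) + 1)) • 1).rank ≤ 2)
    {μ : ℝ} (hμ : μ = (N * Matrix.diagonal fun i => (D i)⁻¹).trace - 1 -
      (Fintype.card ι - 2) * (1 / ((t : ℝ) + 1)))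
    (hμ1 : μ ≤ 1 / ((t : ℝ) + 1)) (hμ2 : -(t / ((t : ℝ) + 1)) ≤ μ) :
    (sortedEigenvalues W).getD 1 0 ≤ 1 / ((t : ℝ) + 1) ∧
      (μ = 1 / ((t : ℝ) + 1) ∨ 3 ≤ Fintype.card ι →
        (sortedEigenvalues W).getD 1 0 = 1 / ((t : ℝ) + 1)) := by
  set P := N * Matrix.diagonal fun i => (D i)⁻¹
  set c : ℝ := 1 / ((t : ℝ) + 1)
  have ht1 : (1 : ℝ) ≤ t := by exact_mod_cast ht
  have hc0 : 0 < c := by positivity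
  have hc1 : c < 1 := by
    rw [div_lt_one (by linarith)]; linarith
  have htc : (t : ℝ) / ((t : ℝ) + 1) = t * c := by rw [mul_one_div]
  have hβ' : (t : ℝ) ≤ (Fintype.card β : ℝ) - 1 := by
    have : ((t + 1 : ℕ) : ℝ) ≤ Fintype.card β := by exact_mod_cast hβ
    push_cast at this; linarith
  obtain ⟨d, hd⟩ := exists_diagonalizedBy_mul_diagonal hN hD
  have : Nonempty ι := Fintype.card_pos_iff.1 (by omega)
  obtain ⟨i₀, hi₀⟩ := hd.exists_eq_of_mulVec (f := D)
    (fun h => (hD (Classical.arbitrary ι)).ne' (by rw [h]; rfl)) (mul_diagonal_inv_mulVec hD hND)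
  obtain ⟨i₁, hne, hi₁, hrest⟩ := hd.exists_of_rank_le_two hc1.ne hrank hi₀ hι
  rw [← hμ] at hi₁
  have hle : ∀ j, j ≠ i₀ → d j ≤ c := fun j hj => by
    by_cases hj1 : j = i₁
    · rw [hj1, hi₁]; exact hμ1
    · exact (hrest j hj hj1).le
  have hneg : ∀ j, -d j ≤ c * ((Fintype.card β : ℝ) - 1) := by
    have hct : (t : ℝ) * c ≤ c * ((Fintype.card β : ℝ) - 1) := by
      rw [mul_comm]; exact mul_le_mul_of_nonneg_left hβ' hc0.le
    have h0 : 0 ≤ (t : ℝ) * c := by positivity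
    intro j
    by_cases hj : j = i₀
    · rw [hj, hi₀]; linarith
    by_cases hj1 : j = i₁
    · rw [hj1, hi₁]; linarith
    · rw [hrest j hj hj1]; linarith
  refine ⟨sortedEigenvalues_kronecker_moveMatrix_le hd (by omega) hW hi₀ hc1.le hle hneg, ?_⟩
  intro hor
  obtain ⟨j, hj, hjc⟩ : ∃ j, j ≠ i₀ ∧ d j = c := by
    rcases hor with h | h
    · exact ⟨i₁, hne, hi₁.trans h⟩
    · obtain ⟨j, hj⟩ : ∃ j, j ∉ ({i₀, i₁} : Finset ι) := by
        by_contra! hall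
        have h1 := card_le_card (fun j _ => hall j : univ ⊆ ({i₀, i₁} : Finset ι))
        have h2 : #({i₀, i₁} : Finset ι) ≤ 2 := card_le_two
        rw [card_univ] at h1
        omega
      simp only [mem_insert, mem_singleton, not_or] at hj
      exact ⟨j, hj.1, hrest j hj.1 hj.2⟩
  rw [← hjc]
  rw [← hjc] at hle hneg hc1
  exact sortedEigenvalues_kronecker_moveMatrix hd (by omega) hW hi₀ hj hc1.le hle hneg

/-! ### Links of nonempty faces -/

namespace WeightedGraph

variable {V : Type*} {G : WeightedGraph V} {H s : ℕ}

theorem adjMatrix_pos (hw : ∀ e ∈ G.graph.edgeSet, 0 < G.weight e) {u v : V}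
    (h : G.graph.Adj u v) : 0 < G.adjMatrix u v := by
  rw [G.adjMatrix_of_adj h]
  exact hw _ h

theorem adjMatrix_nonneg (hw : ∀ e ∈ G.graph.edgeSet, 0 < G.weight e) (u v : V) :
    0 ≤ G.adjMatrix u v := by
  by_cases h : G.graph.Adj u v
  · exact (adjMatrix_pos hw h).le
  · rw [G.adjMatrix_of_not_adj h]

theorem sum_adjMatrix_subtype [Fintype V] (u : V) [Fintype {v // G.graph.Adj u v}] :
    ∑ v : {v // G.graph.Adj u v}, G.adjMatrix u v = G.degree u := by
  classical
  rw [degree, ← sum_filter_add_sum_filter_not univ (fun v => G.graph.Adj u v)]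
  rw [sum_eq_zero (s := {v | ¬ G.graph.Adj u v}), add_zero]
  · exact (sum_subtype _ (fun v => by simp) _).symm
  · intro v hv
    exact G.adjMatrix_of_not_adj (mem_filter.1 hv).2

theorem degree_pos [Fintype V] (hw : ∀ e ∈ G.graph.edgeSet, 0 < G.weight e) {u v : V}
    (h : G.graph.Adj u v) : 0 < G.degree u :=
  sum_pos' (fun _ _ => adjMatrix_nonneg hw _ _) ⟨v, mem_univ v, adjMatrix_pos hw h⟩

variable [DecidableEq V]

theorem injOn_insert_insert {σ : Finset (V × Fin s)}
    (hinj : Set.InjOn Prod.snd (σ : Set (V × Fin s))) {x y : V} {b b' : Fin s}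
    (hb : b ∉ σ.image Prod.snd) (hb' : b' ∉ σ.image Prod.snd) (hbb : b ≠ b') :
    b ∉ (insert (y, b') σ).image Prod.snd ∧
    Set.InjOn Prod.snd
      ((insert (x, b) (insert (y, b') σ) : Finset (V × Fin s)) : Set (V × Fin s)) ∧
      #(insert (x, b) (insert (y, b') σ)) = #σ + 2 := by
  have h1 := injOn_snd_insert (z := y) hinj hb'
  have h2 : b ∉ (insert (y, b') σ).image Prod.snd := by
    rw [image_insert]
    simp only [mem_insert, not_or]
    exact ⟨hbb, hb⟩
  refine ⟨h2, injOn_snd_insert h1 h2, ?_⟩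
  rw [card_insert_of_notMem (notMem_of_snd_notMem h2),
    card_insert_of_notMem (notMem_of_snd_notMem hb')]

variable [Fintype V]

theorem linkGap_eq (σ : Finset (V × Fin s)) :
    (G.productComplex H s).linkGap σ = 1 -
      (sortedEigenvalues ((G.productComplex H s).link σ).skeleton.walkMatrix).getD 1 0 := rfl

/-- The expansion of the link of a face that meets both fibres over an edge. The first factor of the
walk is a `2 × 2` matrix with diagonal `(a + 1) / (t + 1)`, `(b + 1) / (t + 1)`, where `a + b = t`. -/
theorem linkGap_of_image_eq_pair (hw : ∀ e ∈ G.graph.edgeSet, 0 < G.weight e)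
    {σ : Finset (V × Fin s)} (hσ : #σ + 1 ≤ H) (hs : 2 * #σ + 1 ≤ s) (hHs : H + 1 ≤ s)
    (hinj : Set.InjOn Prod.snd (σ : Set (V × Fin s))) {u v : V} (huv : G.graph.Adj u v)
    (hI : σ.image Prod.fst = {u, v}) :
    (G.productComplex H s).linkGap σ = (#σ : ℝ) / (#σ + 1) := by
  have hu : 1 ≤ #{x ∈ σ | x.1 = u} := card_filter_pos (by simp [hI])
  have hv : 1 ≤ #{x ∈ σ | x.1 = v} := card_filter_pos (by simp [hI])
  have hab := card_filter_add_card_filter huv.ne hI.subset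
  set a := #{x ∈ σ | x.1 = u}
  set b := #{x ∈ σ | x.1 = v}
  have habR : (#σ : ℝ) = a + b := by rw [← hab]; push_cast; ring
  have hcf : 0 < colorFactor H s (#σ + 2) * G.adjMatrix u v :=
    mul_pos (colorFactor_pos (by omega) hHs _) (adjMatrix_pos hw huv)
  set κ := colorFactor H s (#σ + 2) * G.adjMatrix u v
  let g : Bool → V := fun i => if i then u else v
  let N : Matrix Bool Bool ℝ := Matrix.of fun i j =>
    κ * natBeta (a + (i.toNat + j.toNat)) (b + ((!i).toNat + (!j).toNat))
  let D : Bool → ℝ := fun i => κ * natBeta (a + i.toNat) (b + (!i).toNat)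
  have hD : ∀ i, 0 < D i := fun i => mul_pos hcf (natBeta_pos _ _)
  have hND : ∀ i, ∑ j, N i j = D i := by
    intro i
    rw [Fintype.sum_bool]
    cases i
    · simpa [N, D, ← mul_add, add_assoc] using
        congrArg (κ * ·) (natBeta_succ_add (a := a) (b := b + 1) hu (by omega))
    · simpa [N, D, ← mul_add, add_assoc] using
        congrArg (κ * ·) (natBeta_succ_add (a := a + 1) (b := b) (by omega) hv)
  have hN : N.IsSymm := by
    ext i j
    simp only [N, Matrix.transpose_apply, Matrix.of_apply]
    rw [add_comm j.toNat, add_comm (!j).toNat]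
  have hIg : ∀ i, insert (g i) ({u, v} : Finset V) = {u, v} := by
    intro i; cases i <;> simp [g]
  have hcount : ∀ (i : Bool) (τ : Finset (V × Fin s)) (c : Fin s), c ∉ τ.image Prod.snd →
      #{x ∈ insert (g i, c) τ | x.1 = u} = #{x ∈ τ | x.1 = u} + i.toNat ∧
      #{x ∈ insert (g i, c) τ | x.1 = v} = #{x ∈ τ | x.1 = v} + (!i).toNat := by
    intro i τ c hc
    cases i
    · exact ⟨card_filter_insert_of_ne huv.ne', card_filter_insert_self hc⟩
    · exact ⟨card_filter_insert_self hc, card_filter_insert_of_ne huv.ne⟩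
  have hW := charpoly_walkMatrix_link (G := G) (H := H) (σ := σ) (g := g) (N := N) (D := D)
    (by
      intro i j hij
      cases i <;> cases j <;> simp [g, huv.ne, huv.ne'] at hij ⊢)
    (by
      intro z c hc
      constructor
      · intro hF
        obtain ⟨u', v', huv', hsub⟩ := exists_adj_of_mem_faces hF
        rw [image_insert, hI] at hsub
        have heq := pair_eq_of_pair_subset huv.ne ((subset_insert z _).trans hsub)
        have hz := hsub (mem_insert_self _ _)
        rw [← heq, mem_insert, mem_singleton] at hz
        rcases hz with rfl | rfl
        · exact ⟨true, rfl⟩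
        · exact ⟨false, rfl⟩
      · rintro ⟨i, rfl⟩
        refine mem_faces_of_image_eq_pair hHs (injOn_snd_insert hinj hc) ?_ huv ?_
        · rw [card_insert_of_notMem (notMem_of_snd_notMem hc)]; omega
        · rw [image_insert, hI, hIg])
    hND
    (by
      intro i j c c' hc hc' hcc
      obtain ⟨h1, h2, h3⟩ := injOn_insert_insert (x := g i) (y := g j) hinj hc hc' hcc
      rw [faceValue_of_image_eq_pair hHs h2 (by omega) huv
        (by rw [image_insert, image_insert, hI, hIg, hIg]), h3, (hcount i _ c h1).1,
        (hcount i _ c h1).2, (hcount j _ c' hc').1, (hcount j _ c' hc').2]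
      simp only [N, Matrix.of_apply, κ]
      rw [add_comm i.toNat, add_comm (!i).toNat, ← add_assoc, ← add_assoc]
      simp only [a, b]
      ring)
  have ht1 : 1 ≤ #σ := by omega
  have hpos : (0 : ℝ) < (a : ℝ) + b + 1 := by positivity
  have hkey := second_eigenvalue_of_rank_le_two hN hD hND hW ht1
    (by rw [card_unused hinj]; omega) (by simp)
    ((Matrix.rank_le_card_width _).trans (by simp)) (μ := 1 / ((#σ : ℝ) + 1))
    (by
      have hna := natBeta_succ_left (a := a + 1) (b := b) (by omega) hv
      have hnb := natBeta_succ_right (a := a) (b := b + 1) hu (by omega)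
      have h1 : N true true * (D true)⁻¹ = (a + 1) / (a + b + 1) := by
        have := (natBeta_pos (a + 1) b).ne'
        have h3 : (a : ℝ) + 1 + b ≠ 0 := by positivity
        simp only [N, D, Matrix.of_apply, Bool.toNat_true, Bool.not_true, Bool.toNat_false,
          add_zero]
        rw [← add_assoc, hna]
        push_cast
        field_simp
        ring
      have h2 : N false false * (D false)⁻¹ = (b + 1) / (a + b + 1) := by
        have := (natBeta_pos a (b + 1)).ne'
        have h3 : (a : ℝ) + (b + 1) ≠ 0 := by positivity
        simp only [N, D, Matrix.of_apply, Bool.toNat_true, Bool.not_false, Bool.toNat_false,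
          add_zero]
        rw [← add_assoc, hnb]
        push_cast
        field_simp
        ring
      rw [Matrix.trace, Fintype.sum_bool, Matrix.diag_apply, Matrix.diag_apply,
        Matrix.mul_diagonal, Matrix.mul_diagonal, h1, h2, Fintype.card_bool, habR]
      push_cast
      field_simp
      ring)
    le_rfl
    ((neg_nonpos.2 (by positivity)).trans (by positivity))
  rw [linkGap_eq, hkey.2 (Or.inl rfl), habR]
  field_simp
  ring

/-- The expansion of the link of a nonempty face inside one fibre. The vertices of the link lie over
`u`, which is encoded as `none`, and its neighbours. Functions on the neighbours with sum `0` are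
eigenvectors for `1 / (t + 1)`, and nonzero ones exist only if there are two neighbours. -/
theorem linkGap_of_image_eq_singleton (hw : ∀ e ∈ G.graph.edgeSet, 0 < G.weight e)
    {σ : Finset (V × Fin s)} (hσ : #σ + 1 ≤ H) (hs : 2 * #σ + 1 ≤ s) (hHs : H + 1 ≤ s)
    (hinj : Set.InjOn Prod.snd (σ : Set (V × Fin s))) {u v₀ : V} (huv₀ : G.graph.Adj u v₀)
    (hI : σ.image Prod.fst = {u}) :
    (#σ : ℝ) / (#σ + 1) ≤ (G.productComplex H s).linkGap σ ∧
      (2 ≤ (G.graph.neighborSet u).ncard →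
        (G.productComplex H s).linkGap σ = (#σ : ℝ) / (#σ + 1)) := by
  classical
  have hcard := card_filter_of_image_eq hI
  have ht1 : 1 ≤ #σ := by
    rw [← hcard]
    exact card_filter_pos (by simp [hI])
  set t := #σ with ht
  have hκ : 0 < colorFactor H s (t + 2) := colorFactor_pos (by omega) hHs _
  set κ := colorFactor H s (t + 2)
  have hd : 0 < G.degree u := degree_pos hw huv₀
  have htail : harmonicTail H (t + 1) = 1 / ((t : ℝ) + 1) + harmonicTail H (t + 2) := by
    rw [harmonicTail_eq hσ]; push_cast; rfl
  have htail0 := harmonicTail_nonneg H (t + 2)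
  have hcpos : 0 < 1 / ((t : ℝ) + 1) := by positivity
  have htail1 : 0 < harmonicTail H (t + 1) := by rw [htail]; linarith
  have hB2 : natBeta (t + 1) 1 = 1 / ((t : ℝ) + 1) := by
    rw [natBeta_one (by omega)]; push_cast; rfl
  have hB3 : natBeta t 2 = 1 / ((t : ℝ) + 1) * natBeta t 1 := by
    rw [natBeta_succ_right ht1 le_rfl]; push_cast; rfl
  let ι := Option {v // G.graph.Adj u v}
  let g : ι → V := fun i => i.elim u Subtype.val
  let N : Matrix ι ι ℝ := Matrix.of fun i j =>
    match i, j with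
    | none, none => κ * (G.degree u * harmonicTail H (t + 2))
    | none, some v => κ * (G.adjMatrix u v * natBeta (t + 1) 1)
    | some v, none => κ * (G.adjMatrix u v * natBeta (t + 1) 1)
    | some v, some v' => if v = v' then κ * (G.adjMatrix u v * natBeta t 2) else 0
  let D : ι → ℝ := fun i =>
    i.elim (κ * (G.degree u * harmonicTail H (t + 1)))
      (fun v => κ * (G.adjMatrix u v * natBeta t 1))
  have hD : ∀ i, 0 < D i := by
    rintro (_ | v)
    · exact mul_pos hκ (mul_pos hd htail1)
    · exact mul_pos hκ (mul_pos (adjMatrix_pos hw v.2) (natBeta_pos _ _))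
  have hND : ∀ i, ∑ j, N i j = D i := by
    rintro (_ | v)
    · rw [Fintype.sum_option]
      simp only [N, D, Matrix.of_apply, Option.elim]
      rw [← mul_sum, ← sum_mul, sum_adjMatrix_subtype, hB2, htail]
      ring
    · rw [Fintype.sum_option]
      simp only [N, D, Matrix.of_apply, Option.elim, sum_ite_eq, mem_univ, if_true]
      rw [← mul_add, ← mul_add, natBeta_succ_add ht1 le_rfl]
  have hN : N.IsSymm := by
    ext i j
    rcases i with _ | v <;> rcases j with _ | v' <;>
      simp only [N, Matrix.transpose_apply, Matrix.of_apply]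
    by_cases h : v = v'
    · subst h; rfl
    · rw [if_neg h, if_neg (Ne.symm h)]
  have hcount0 : ∀ {z : V}, z ≠ u → #{x ∈ σ | x.1 = z} = 0 := by
    intro z hz
    rw [filter_false_of_mem, card_empty]
    intro x hx hxz
    have : x.1 ∈ σ.image Prod.fst := mem_image_of_mem _ hx
    rw [hI, mem_singleton] at this
    exact hz (hxz.symm.trans this)
  have hval_pair : ∀ {v : V} {c c' : Fin s}, G.graph.Adj u v → c ∉ σ.image Prod.snd →
      c' ∉ σ.image Prod.snd → c ≠ c' →
      G.faceValue H (insert (v, c) (insert (u, c') σ)) =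
        κ * (G.adjMatrix u v * natBeta (t + 1) 1) := by
    intro v c c' huv hc hc' hcc
    obtain ⟨h1, h2, h3⟩ := injOn_insert_insert (x := v) (y := u) hinj hc hc' hcc
    rw [faceValue_of_image_eq_pair hHs h2 (by omega) huv
      (by rw [image_insert, image_insert, hI]; ext; simp [or_comm]), h3,
      card_filter_insert_of_ne huv.ne', card_filter_insert_self hc', card_filter_insert_self h1,
      card_filter_insert_of_ne huv.ne, hcard, hcount0 huv.ne']
  have hW := charpoly_walkMatrix_link (G := G) (H := H) (σ := σ) (g := g) (N := N) (D := D)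
    (by
      rintro (_ | v) (_ | v') h
      · rfl
      · exact absurd h v'.2.ne
      · exact absurd h v.2.ne'
      · exact congrArg some (Subtype.ext h))
    (by
      intro z c hc
      have hcz : #(insert (z, c) σ) = t + 1 := card_insert_of_notMem (notMem_of_snd_notMem hc)
      constructor
      · intro hF
        by_cases hzu : z = u
        · exact ⟨none, hzu.symm⟩
        obtain ⟨u', v', huv', hsub⟩ := exists_adj_of_mem_faces hF
        rw [image_insert, hI] at hsub
        have hz : z ∈ ({u', v'} : Finset V) := hsub (by simp)
        have hu : u ∈ ({u', v'} : Finset V) := hsub (by simp)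
        simp only [mem_insert, mem_singleton] at hz hu
        have hadj : G.graph.Adj u z := by
          rcases hz with rfl | rfl <;> rcases hu with rfl | rfl
          · exact absurd rfl hzu
          · exact huv'.symm
          · exact huv'
          · exact absurd rfl hzu
        exact ⟨some ⟨z, hadj⟩, rfl⟩
      · rintro ⟨_ | v, rfl⟩
        · exact mem_faces_of_image_subset_singleton hHs (injOn_snd_insert hinj hc) (by omega) huv₀
            (by rw [image_insert, hI]; simp [g])
        · exact mem_faces_of_image_eq_pair hHs (injOn_snd_insert hinj hc) (by omega) v.2
            (by rw [image_insert, hI, pair_comm]; rfl))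
    hND
    (by
      rintro (_ | v) (_ | v') c c' hc hc' hcc
      · obtain ⟨h1, h2, h3⟩ := injOn_insert_insert (x := u) (y := u) hinj hc hc' hcc
        refine (faceValue_of_image_eq_singleton hHs h2 (by omega) (u := u)
          (by rw [image_insert, image_insert, hI]; simp)).trans ?_
        rw [h3]
        rfl
      · rw [insert_comm]
        exact hval_pair v'.2 hc' hc hcc.symm
      · exact hval_pair v.2 hc hc' hcc
      · obtain ⟨h1, h2, h3⟩ := injOn_insert_insert (x := v.1) (y := v'.1) hinj hc hc' hcc
        simp only [g, N, Matrix.of_apply, Option.elim]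
        split_ifs with h
        · subst h
          rw [faceValue_of_image_eq_pair hHs h2 (by omega) v.2
            (by rw [image_insert, image_insert, hI]; ext; simp [or_comm]), h3,
            card_filter_insert_of_ne v.2.ne', card_filter_insert_of_ne v.2.ne',
            card_filter_insert_self h1, card_filter_insert_self hc', hcard, hcount0 v.2.ne']
        · refine faceValue_of_forall_not_subset fun u' v'' _ hsub => ?_
          rw [image_insert, image_insert, hI] at hsub
          have h3 : #({v.1, v'.1, u} : Finset V) = 3 :=
            card_eq_three.2 ⟨_, _, _, fun h' => h (Subtype.ext h'), v.2.ne', v'.2.ne', rfl⟩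
          exact absurd (h3.symm.le.trans ((card_le_card hsub).trans card_le_two)) (by norm_num))
  have hcardι : Fintype.card ι = (G.graph.neighborSet u).ncard + 1 := by
    rw [Fintype.card_option, ← Nat.card_coe_set_eq, ← Nat.card_eq_fintype_card]
    rfl
  have hncard : 1 ≤ (G.graph.neighborSet u).ncard :=
    (Set.ncard_pos (Set.toFinite _)).2 ⟨v₀, huv₀⟩
  set P := N * Matrix.diagonal fun i => (D i)⁻¹ with hP
  have hPsome : ∀ v, P (some v) (some v) = 1 / ((t : ℝ) + 1) := by
    intro v
    have h1 := (adjMatrix_pos hw v.2).ne'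
    have h2 := (natBeta_pos t 1).ne'
    rw [hP, Matrix.mul_diagonal]
    simp only [N, D, Matrix.of_apply, Option.elim, if_true]
    rw [hB3]
    field_simp
  have hPne : ∀ v v', v ≠ v' → P (some v) (some v') = 0 := by
    intro v v' h
    rw [hP, Matrix.mul_diagonal]
    simp [N, h]
  have hPnone : P none none = harmonicTail H (t + 2) / harmonicTail H (t + 1) := by
    rw [hP, Matrix.mul_diagonal]
    simp only [N, D, Matrix.of_apply, Option.elim]
    field_simp
  have htrace : P.trace = harmonicTail H (t + 2) / harmonicTail H (t + 1) +
      Fintype.card {v // G.graph.Adj u v} * (1 / ((t : ℝ) + 1)) := by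
    rw [Matrix.trace, Fintype.sum_option, Matrix.diag_apply, hPnone]
    simp only [Matrix.diag_apply, hPsome, sum_const, card_univ, nsmul_eq_mul]
  -- Apart from the row and the column of `u`, the matrix `P - 1 / (t + 1)` vanishes.
  have hrank : (P - (1 / ((t : ℝ) + 1)) • 1).rank ≤ 2 := by
    set Q := P - (1 / ((t : ℝ) + 1)) • (1 : Matrix ι ι ℝ) with hQ
    let A : Matrix ι Bool ℝ := Matrix.of fun i k =>
      if k then (if i = none then 1 else 0) else (if i = none then 0 else Q i none)
    let B : Matrix Bool ι ℝ := Matrix.of fun k j =>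
      if k then Q none j else (if j = none then 1 else 0)
    have hAB : Q = A * B := by
      ext i j
      rw [Matrix.mul_apply, Fintype.sum_bool]
      rcases i with _ | v <;> rcases j with _ | v'
      · simp [A, B]
      · simp [A, B]
      · simp [A, B]
      · by_cases h : v = v'
        · subst h
          simp [A, B, hQ, hPsome]
        · simp [A, B, hQ, hPne v v' h, h]
    rw [hAB]
    exact (Matrix.rank_mul_le_left _ _).trans ((Matrix.rank_le_card_width _).trans (by simp))
  have hkey := second_eigenvalue_of_rank_le_two hN hD hND hW ht1
    (by rw [card_unused hinj]; omega) (by omega) hrank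
    (μ := 1 / ((t : ℝ) + 1) - 1 / ((t : ℝ) + 1) / harmonicTail H (t + 1))
    (by
      rw [htrace]
      have : (Fintype.card ι : ℝ) = (Fintype.card {v // G.graph.Adj u v} : ℝ) + 1 := by
        rw [Fintype.card_option]; push_cast; rfl
      rw [this]
      have h1 : harmonicTail H (t + 2) = harmonicTail H (t + 1) - 1 / ((t : ℝ) + 1) := by
        rw [htail]; ring
      rw [h1, sub_div, div_self htail1.ne']
      ring)
    (by
      have : 0 ≤ 1 / ((t : ℝ) + 1) / harmonicTail H (t + 1) := by positivity
      linarith)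
    (by
      have h1 : 1 / ((t : ℝ) + 1) / harmonicTail H (t + 1) ≤ 1 := by
        rw [div_le_one htail1, htail]; linarith
      have h2 : (t : ℝ) / ((t : ℝ) + 1) = 1 - 1 / ((t : ℝ) + 1) := by field_simp; ring
      linarith)
  have h2 : (t : ℝ) / ((t : ℝ) + 1) = 1 - 1 / ((t : ℝ) + 1) := by field_simp; ring
  rw [linkGap_eq, h2]
  refine ⟨by linarith [hkey.1], fun h => ?_⟩
  rw [hkey.2 (Or.inr (by omega))]

end WeightedGraph

/-! ### The link of the empty face -/

namespace WeightedGraph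

variable {V : Type*} [DecidableEq V] [Fintype V] {G : WeightedGraph V} {H s : ℕ}

/-- The eigenvalues of the random walk on a graph: they lie in `[-1, 1]`, sum to `0`, the value `1`
occurs among them, and the largest of the others is the second eigenvalue. -/
theorem exists_diagonalizedBy_walkMatrix [Nontrivial V]
    (hw : ∀ e ∈ G.graph.edgeSet, 0 < G.weight e) (hdeg : ∀ u, ∃ v, G.graph.Adj u v) :
    ∃ (d : V → ℝ) (i₀ i₁ : V), DiagonalizedBy G.walkMatrix d ∧ (∀ i, |d i| ≤ 1) ∧ ∑ i, d i = 0 ∧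
      d i₀ = 1 ∧ i₁ ≠ i₀ ∧ (∀ j, j ≠ i₀ → d j ≤ d i₁) ∧ G.secondEigenvalue = d i₁ := by
  have hD : ∀ u, 0 < G.degree u := fun u => by
    obtain ⟨v, hv⟩ := hdeg u
    exact degree_pos hw hv
  obtain ⟨d, hd⟩ := exists_diagonalizedBy_mul_diagonal G.adjMatrix_isSymm hD
  have habs := hd.abs_le_one
    (fun i j => by
      rw [Matrix.mul_diagonal]
      exact mul_nonneg (adjMatrix_nonneg hw _ _) (inv_nonneg.2 (hD j).le))
    (fun j => by
      simp only [Matrix.mul_diagonal]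
      rw [← sum_mul, sum_congr rfl fun i _ => (G.adjMatrix_isSymm.apply i j).symm]
      exact mul_inv_cancel₀ (hD j).ne')
  obtain ⟨u⟩ : Nonempty V := inferInstance
  obtain ⟨i₀, hi₀⟩ := hd.exists_eq_of_mulVec (f := G.degree)
    (fun h => (hD u).ne' (by rw [h]; rfl)) (mul_diagonal_inv_mulVec hD fun _ => rfl)
  obtain ⟨i₁, hne, hmax⟩ := exists_max_ne d i₀
  refine ⟨d, i₀, i₁, hd, habs, ?_, hi₀, hne, hmax, ?_⟩
  · rw [← hd.trace, Matrix.trace]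
    refine sum_eq_zero fun u _ => ?_
    rw [Matrix.diag_apply, Matrix.mul_diagonal, G.adjMatrix_of_not_adj (G.graph.loopless.irrefl u),
      zero_mul]
  · exact sortedEigenvalues_getD_one hd.roots_charpoly hne
      (by rw [hi₀]; exact (abs_le.1 (habs i₁)).2) hmax

theorem spectralGap_nonneg [Nontrivial V] (hw : ∀ e ∈ G.graph.edgeSet, 0 < G.weight e)
    (hdeg : ∀ u, ∃ v, G.graph.Adj u v) : 0 ≤ G.spectralGap := by
  obtain ⟨d, i₀, i₁, -, habs, -, -, -, -, h⟩ := exists_diagonalizedBy_walkMatrix hw hdeg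
  rw [spectralGap, h]
  linarith [(abs_le.1 (habs i₁)).2]

/-- The expansion of the 1-skeleton of the whole complex. With `h = 1 + 1/2 + ⋯ + 1/H`, the first
factor of the walk is the lazy walk `(1 - 1 / h) + (1 / h) W` on `G`. -/
theorem linkGap_empty (hw : ∀ e ∈ G.graph.edgeSet, 0 < G.weight e)
    (hdeg : ∀ u, ∃ v, G.graph.Adj u v) (hH : 2 ≤ H) (hs : H + 1 ≤ s) (hs4 : 4 ≤ s)
    (hn : 4 ≤ Fintype.card V) :
    (G.productComplex H s).linkGap ∅ = G.spectralGap / harmonicTail H 1 := by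
  have : Nontrivial V := Fintype.one_lt_card_iff_nontrivial.1 (by omega)
  obtain ⟨d, i₀, i₁, hd, habs, hsum, hi₀, hne, hmax, hω⟩ := exists_diagonalizedBy_walkMatrix hw hdeg
  have hdpos : ∀ u, 0 < G.degree u := fun u => by
    obtain ⟨v, hv⟩ := hdeg u
    exact degree_pos hw hv
  have htail : harmonicTail H 1 = 1 + harmonicTail H 2 := by
    rw [harmonicTail_eq (by omega)]; norm_num
  have htail2 : (1 : ℝ) / 2 ≤ harmonicTail H 2 := by
    rw [harmonicTail_eq hH]
    have := harmonicTail_nonneg H 3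
    push_cast
    linarith
  set h := harmonicTail H 1
  have hh : (3 : ℝ) / 2 ≤ h := by linarith
  have hh0 : 0 < h := by linarith
  have hκ : 0 < colorFactor H s 2 := colorFactor_pos (by omega) hs _
  set κ := colorFactor H s 2
  let N : Matrix V V ℝ := Matrix.of fun u v =>
    κ * ((if u = v then G.degree u * harmonicTail H 2 else 0) + G.adjMatrix u v)
  let D : V → ℝ := fun u => κ * (G.degree u * h)
  have hND : ∀ u, ∑ v, N u v = D u := by
    intro u
    simp only [N, D, Matrix.of_apply, ← mul_sum, sum_add_distrib, sum_ite_eq, mem_univ, if_true]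
    change κ * (_ + G.degree u) = _
    rw [htail]
    ring
  have hinj : Set.InjOn Prod.snd ((∅ : Finset (V × Fin s)) : Set (V × Fin s)) := by simp
  have hW := charpoly_walkMatrix_link (G := G) (H := H) (σ := (∅ : Finset (V × Fin s)))
    (g := id) (N := N) (D := D) Function.injective_id
    (by
      intro z c hc
      obtain ⟨v, hv⟩ := hdeg z
      refine ⟨fun _ => ⟨z, rfl⟩, fun _ => ?_⟩
      refine mem_faces_of_image_subset_singleton hs (injOn_snd_insert hinj hc) ?_ hv (by simp)
      simp only [insert_empty_eq, card_singleton]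
      omega)
    hND
    (by
      intro u v c c' hc hc' hcc
      obtain ⟨h1, h2, h3⟩ := injOn_insert_insert (x := u) (y := v) hinj hc hc' hcc
      rw [card_empty, zero_add] at h3
      simp only [id, N, Matrix.of_apply]
      by_cases huv : u = v
      · subst huv
        rw [faceValue_of_image_eq_singleton hs h2 (by omega) (u := u) (by simp), h3, if_pos rfl,
          G.adjMatrix_of_not_adj (G.graph.loopless.irrefl u), add_zero]
      · rw [if_neg huv, zero_add]
        by_cases hadj : G.graph.Adj u v
        · rw [faceValue_of_image_eq_pair hs h2 (by omega) hadj (by simp), h3,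
            card_filter_insert_self h1, card_filter_insert_of_ne (Ne.symm huv),
            card_filter_insert_of_ne huv, card_filter_insert_self hc']
          simp [natBeta, κ]
        · rw [G.adjMatrix_of_not_adj hadj, mul_zero]
          refine faceValue_of_forall_not_subset fun u' v' huv' hsub => hadj ?_
          have hsub' : ({u, v} : Finset V) ⊆ {u', v'} := by
            simpa [image_insert] using hsub
          have hu := hsub' (mem_insert_self u {v})
          have hv := hsub' (mem_insert_of_mem (mem_singleton_self v))
          simp only [mem_insert, mem_singleton] at hu hv
          rcases hu with rfl | rfl <;> rcases hv with rfl | rfl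
          · exact absurd rfl huv
          · exact huv'
          · exact huv'.symm
          · exact absurd rfl huv)
  have hP : (N * Matrix.diagonal fun u => (D u)⁻¹) =
      (1 - 1 / h) • (1 : Matrix V V ℝ) + (1 / h) • G.walkMatrix := by
    have h2 : harmonicTail H 2 = h - 1 := by rw [htail]; ring
    ext u v
    have hv := (hdpos v).ne'
    simp only [walkMatrix, Matrix.add_apply, Matrix.smul_apply, Matrix.mul_diagonal, smul_eq_mul,
      N, D, Matrix.of_apply, h2]
    by_cases huv : u = v
    · subst huv
      rw [if_pos rfl, Matrix.one_apply_eq]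
      field_simp
    · rw [if_neg huv, Matrix.one_apply_ne huv]
      field_simp
      ring
  rw [hP] at hW
  have hd' := hd.affine (1 - 1 / h) (1 / h)
  have hinv : 1 / h ≤ 2 / 3 := by
    rw [div_le_iff₀ hh0]; linarith
  have hinv0 : 0 < 1 / h := by positivity
  have hcard : Fintype.card {b : Fin s // b ∉ (∅ : Finset (V × Fin s)).image Prod.snd} = s := by
    rw [card_unused hinj]; simp
  -- The eigenvalues of `W` other than `1` sum to `-1`, and there are at least three.
  have hω3 : -(1 / 3) ≤ d i₁ := by
    have h1 : ∑ j ∈ univ.erase i₀, d j = -1 := by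
      have := add_sum_erase univ d (mem_univ i₀)
      rw [hsum, hi₀] at this
      linarith
    have h2 : ∑ j ∈ univ.erase i₀, d j ≤ #(univ.erase i₀) • d i₁ :=
      sum_le_card_nsmul _ _ _ fun j hj => hmax j (ne_of_mem_erase hj)
    rw [h1, card_erase_of_mem (mem_univ _), card_univ, nsmul_eq_mul, Nat.cast_sub (by omega),
      Nat.cast_one] at h2
    have h3 : (4 : ℝ) ≤ Fintype.card V := by exact_mod_cast hn
    by_contra! hlt
    nlinarith
  have hle1 : d i₁ ≤ 1 := (abs_le.1 (habs i₁)).2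
  have hs4' : (4 : ℝ) ≤ s := by exact_mod_cast hs4
  have h1le : 1 - 1 / h + 1 / h * d i₁ ≤ 1 := by nlinarith
  -- The left side is at most `2 / h - 1 ≤ 1 / 3` and the right side at least `(s - 1) / 9`. These
  -- bounds agree for `s = 4`, where `4 ≤ n` and `h ≥ 3 / 2` are used to the full.
  have hneg : ∀ j, -(1 - 1 / h + 1 / h * d j) ≤ (1 - 1 / h + 1 / h * d i₁) * ((s : ℝ) - 1) := by
    intro j
    have hj := (abs_le.1 (habs j)).1
    have hlow : -(1 - 1 / h + 1 / h * d j) ≤ 1 / 3 := by nlinarith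
    have hup : 1 / 9 ≤ 1 - 1 / h + 1 / h * d i₁ := by nlinarith
    nlinarith
  have hkey := sortedEigenvalues_kronecker_moveMatrix hd' (by rw [hcard]; omega) hW
    (i₀ := i₀) (i₁ := i₁) (by simp only [hi₀]; ring) hne h1le
    (fun j hj => by
      have := mul_le_mul_of_nonneg_left (hmax j hj) hinv0.le
      linarith)
    (by rw [hcard]; exact hneg)
  rw [linkGap_eq, hkey, spectralGap, hω]
  ring

end WeightedGraph

/-! ### The local expansions of the complex -/

theorem sum_Icc_one_div_eq_harmonic (H : ℕ) :
    ∑ l ∈ Icc 1 H, 1 / (l : ℝ) = (harmonic H : ℝ) := by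
  rw [harmonic_eq_sum_Icc]
  push_cast
  simp

theorem SimpleGraph.Connected.exists_two_le_ncard_neighborSet {V : Type*} [Fintype V]
    [DecidableEq V] {Γ : SimpleGraph V} (hΓ : Γ.Connected) (hn : 3 ≤ Fintype.card V) :
    ∃ u, 2 ≤ (Γ.neighborSet u).ncard := by
  have : Nontrivial V := Fintype.one_lt_card_iff_nontrivial.1 (by omega)
  by_contra! hlt
  obtain ⟨u⟩ : Nonempty V := inferInstance
  obtain ⟨v, huv⟩ := hΓ.preconnected.exists_adj_of_nontrivial u
  have huniq : ∀ x y z, Γ.Adj x y → Γ.Adj x z → y = z := fun x y z hy hz =>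
    (Set.ncard_le_one (Set.toFinite _)).1 (Nat.le_of_lt_succ (hlt x)) y hy z hz
  obtain ⟨w, hw⟩ : ∃ w, w ∉ ({u, v} : Finset V) := by
    by_contra! hall
    have h1 := card_le_card (fun j _ => hall j : univ ⊆ ({u, v} : Finset V))
    have h2 : #({u, v} : Finset V) ≤ 2 := card_le_two
    rw [card_univ] at h1
    omega
  -- The set `{u, v}` is closed under taking neighbours.
  have hclosed : ∀ {x y : V}, Γ.Walk x y → x ∈ ({u, v} : Finset V) → y ∈ ({u, v} : Finset V) := by
    intro x y p
    induction p with
    | nil => exact id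
    | cons hadj _ ih =>
      intro hx
      apply ih
      simp only [mem_insert, mem_singleton] at hx ⊢
      rcases hx with rfl | rfl
      · exact Or.inr (huniq _ _ _ hadj huv)
      · exact Or.inl (huniq _ _ _ hadj huv.symm)
  obtain ⟨p⟩ := hΓ.preconnected u w
  exact hw (hclosed p (by simp))

theorem mainTheorem2 {V : Type*} [Fintype V] [DecidableEq V] (G : WeightedGraph V)
    (hconn : G.graph.Connected) (hw : ∀ e ∈ G.graph.edgeSet, 0 < G.weight e)
    (H s : ℕ) (hH : 2 ≤ H) (hs : 2 * H ≤ s) (hn : 4 ≤ Fintype.card V) :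
    (∀ k : ℕ, k + 2 ≤ H →
      (G.productComplex H s).HasLocalExpansion k (((k : ℝ) + 1) / ((k : ℝ) + 2)) ∧
      ∀ σ ∈ (G.productComplex H s).facesOfDim k,
        (¬ ∃ u : V, σ.image Prod.fst = {u} ∧ (G.graph.neighborSet u).ncard = 1) →
        (G.productComplex H s).linkGap σ = ((k : ℝ) + 1) / ((k : ℝ) + 2)) ∧
    (G.productComplex H s).HasLocalExpansion (-1)
      (G.spectralGap / ∑ l ∈ Finset.Icc 1 H, 1 / (l : ℝ)) ∧
    G.spectralGap / (1 + Real.log H) ≤ G.spectralGap / ∑ l ∈ Finset.Icc 1 H, 1 / (l : ℝ) := by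
  have : Nontrivial V := Fintype.one_lt_card_iff_nontrivial.1 (by omega)
  have hdeg : ∀ u, ∃ v, G.graph.Adj u v := fun u =>
    hconn.preconnected.exists_adj_of_nontrivial u
  have hHs : H + 1 ≤ s := by omega
  obtain ⟨u₀, hu₀⟩ := hconn.exists_two_le_ncard_neighborSet (by omega)
  obtain ⟨v₀, huv₀⟩ := hdeg u₀
  refine ⟨fun k hk => ?_, ?_, ?_⟩
  · have hgap : ∀ σ ∈ (G.productComplex H s).facesOfDim k,
        ((k : ℝ) + 1) / ((k : ℝ) + 2) ≤ (G.productComplex H s).linkGap σ ∧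
        ((¬ ∃ u : V, σ.image Prod.fst = {u} ∧ (G.graph.neighborSet u).ncard = 1) →
          (G.productComplex H s).linkGap σ = ((k : ℝ) + 1) / ((k : ℝ) + 2)) := by
      intro σ hσ
      obtain ⟨hF, hc⟩ := mem_filter.1 hσ
      have hc' : #σ = k + 1 := by exact_mod_cast hc
      have hinj := WeightedGraph.injOn_of_mem_faces hF
      have hval : ((k : ℝ) + 1) / ((k : ℝ) + 2) = (#σ : ℝ) / (#σ + 1) := by
        rw [hc']; push_cast; congr 1; ring
      rw [hval]
      obtain ⟨u, v, huv, hI⟩ := WeightedGraph.exists_adj_of_mem_faces hF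
      have hone : ∀ {x y : V}, G.graph.Adj x y → σ.image Prod.fst = {x} →
          (#σ : ℝ) / (#σ + 1) ≤ (G.productComplex H s).linkGap σ ∧
          ((¬ ∃ u : V, σ.image Prod.fst = {u} ∧ (G.graph.neighborSet u).ncard = 1) →
            (G.productComplex H s).linkGap σ = (#σ : ℝ) / (#σ + 1)) := by
        intro x y hxy hx
        have h := WeightedGraph.linkGap_of_image_eq_singleton hw (by omega) (by omega) hHs hinj
          hxy hx
        refine ⟨h.1, fun hleaf => h.2 ?_⟩
        have h1 : (G.graph.neighborSet x).ncard ≠ 1 := fun h1 => hleaf ⟨x, hx, h1⟩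
        have h2 : 0 < (G.graph.neighborSet x).ncard := (Set.ncard_pos (Set.toFinite _)).2 ⟨y, hxy⟩
        omega
      have hne : (σ.image Prod.fst).Nonempty := (card_pos.1 (by omega)).image _
      by_cases hu : u ∈ σ.image Prod.fst
      · by_cases hv : v ∈ σ.image Prod.fst
        · have h := WeightedGraph.linkGap_of_image_eq_pair hw (by omega) (by omega) hHs hinj huv
            (hI.antisymm (by simp only [insert_subset_iff, singleton_subset_iff]; exact ⟨hu, hv⟩))
          exact ⟨h.ge, fun _ => h⟩
        · refine hone huv (hne.subset_singleton_iff.1 fun x hx => ?_)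
          rcases mem_insert.1 (hI hx) with rfl | h
          · exact mem_singleton_self _
          · exact absurd (mem_singleton.1 h ▸ hx) hv
      · refine hone huv.symm (hne.subset_singleton_iff.1 fun x hx => ?_)
        rcases mem_insert.1 (hI hx) with rfl | h
        · exact absurd hx hu
        · exact h
    refine ⟨⟨?_, ?_⟩, fun σ hσ => (hgap σ hσ).2⟩
    -- The minimum is attained by a face over a vertex with two neighbours.
    · obtain ⟨B, -, hB⟩ := exists_subset_card_eq (s := (univ : Finset (Fin s))) (n := k + 1)
        (by rw [card_univ, Fintype.card_fin]; omega)
      let σ : Finset (V × Fin s) := B.image fun b => (u₀, b)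
      have hcard : #σ = k + 1 := by
        rw [← hB]
        exact card_image_of_injective _ fun b b' h => (Prod.mk.inj h).2
      have hI : σ.image Prod.fst = {u₀} := by
        rw [image_image]
        exact image_const (card_pos.1 (by omega)) u₀
      have hinj : Set.InjOn Prod.snd (σ : Set (V × Fin s)) := by
        intro x hx y hy hxy
        obtain ⟨b, -, rfl⟩ := mem_image.1 (mem_coe.1 hx)
        obtain ⟨b', -, rfl⟩ := mem_image.1 (mem_coe.1 hy)
        exact Prod.ext rfl hxy
      have hσ : σ ∈ (G.productComplex H s).facesOfDim k := mem_filter.2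
        ⟨WeightedGraph.mem_faces_of_image_subset_singleton hHs hinj (by omega) huv₀ hI,
          by rw [hcard]; push_cast; rfl⟩
      refine ⟨σ, hσ, (hgap σ hσ).2 ?_⟩
      rintro ⟨u, hu, h1⟩
      rw [hI, singleton_inj] at hu
      rw [← hu] at h1
      omega
    · rintro _ ⟨σ, hσ, rfl⟩
      exact (hgap σ hσ).1
  · have hfaces : (G.productComplex H s).facesOfDim (-1) = {∅} := by
      ext σ
      simp only [WeightedComplex.facesOfDim, mem_filter, mem_singleton]
      constructor
      · rintro ⟨-, hc⟩
        exact card_eq_zero.1 (by omega)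
      · rintro rfl
        refine ⟨?_, by simp⟩
        have hmem := WeightedGraph.mem_faces_of_image_subset_singleton (G := G) (H := H) hHs
          (σ := {(u₀, (⟨0, by omega⟩ : Fin s))}) (by simp) (by simp; omega) huv₀ (by simp)
        exact (G.productComplex H s).down_closed _ hmem _ (empty_subset _)
    have hval : G.spectralGap / ∑ l ∈ Finset.Icc 1 H, 1 / (l : ℝ) =
        (G.productComplex H s).linkGap ∅ := by
      rw [WeightedGraph.linkGap_empty hw hdeg hH hHs (by omega) hn]
      rfl
    rw [WeightedComplex.HasLocalExpansion, hfaces, coe_singleton, Set.image_singleton, hval]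
    exact isLeast_singleton
  · have hlog := harmonic_le_one_add_log H
    have hpos : (0 : ℝ) < ∑ l ∈ Finset.Icc 1 H, 1 / (l : ℝ) :=
      sum_pos (fun l hl => by
        have : 0 < l := (mem_Icc.1 hl).1
        positivity) ⟨1, by simp; omega⟩
    rw [← sum_Icc_one_div_eq_harmonic] at hlog
    exact div_le_div_of_nonneg_left (WeightedGraph.spectralGap_nonneg hw hdeg) hpos hlog
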